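/- Let $n\ge 2$. Let $\mathcal H_A',\mathcal H_B'$ be complex Hilbert spaces of arbitrary dimension, let $|\psi'\rangle\in\mathcal H_A'\otimes\mathcal H_B'$ be a unit vector, and let $A_1',\dots,A_n'$ on $\mathcal H_A'$ and $B_1',\dots,B_n'$ on $\mathcal H_B'$ be Hermitian operators with square $\mathbb 1$ (they also denote $A_i'\otimes\mathbb 1$ and $\mathbb 1\otimes B_j'$). Suppose that the chained Bell value is $\varepsilon\ge 0$ below the quantum maximum: $$\langle\psi'|\sum_{i=1}^n\bigl(A_i'\otimes B_i'+A_{i+1}'\otimes B_i'\bigr)|\psi'\rangle=B_n^{\max}-\varepsilon,\qquad A_{n+1}'=-A_1',\quad B_n^{\max}=2n\cos\tfrac{\pi}{2n}.$$ Put $Z_A'=A_1'$ and $Z_B'=(B_1'-B_n')/(2\cos\frac{\pi}{2n})$. For even $n$ put $X_A'=A_{n/2+1}'$ and $X_B'=(B_{n/2}'+B_{n/2+1}')/(2\cos\frac\pi{2n})$; for odd $n$ put $X_A'=(A_{(n+1)/2}'+A_{(n+3)/2}')/(2\cos\frac\pi{2n})$ and $X_B'=B_{(n+1)/2}'$. For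 a self-adjoint $M$ with kernel projector $P$ let $\widetilde M$ be the unitary with $\widetilde M\,|M+P|=M+P$ (for the operators above: $\widetilde M=M$ whenever $M$ is already unitary). Let $\Phi$ be the swap circuit on $\mathcal H_A'\otimes\mathcal H_B'\otimes\mathbb C^2\otimes\mathbb C^2$: each party applies to its ancilla qubit a Hadamard gate, then $\widetilde Z$ controlled by the ancilla, a Hadamard gate, and $\widetilde X$ controlled by the ancilla. Let $|\varphi\rangle=\frac1N(\mathbb 1+Z_A')(\mathbb 1+\widetilde Z_B)|\psi'\rangle$ with $N$ the length of the vector $(\mathbb 1+Z_A')(\mathbb 1+\widetilde Z_B)|\psi'\rangle$ (and $|\varphi\rangle=0$ if $N=0$), $|\phi_+\rangle=(|00\rangle+|11\rangle)/\sqrt2$, and, with the Pauli matrices $X,Z$, $$A_i=\sin\tfrac{(i-1)\pi}{n}X+\cos\tfrac{(i-1)\pi}{n}Z,\qquad B_j=\sin\tfrac{(2j-1)\pi}{2n}X+\cos\tfrac{(2j-1)\pi}{2n}Z .$$ Then there are functions $f,f_{A_i},f_{B_j},f_{ij}$ of $(\varepsilon,n)$ alone (not of the Hilbert spaces, the state or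 the measurements) such that for all $i,j\in\{1,\dots,n\}$ $$\|\Phi(A_i'B_j'|\psi'\rangle|00\rangle)-|\varphi\rangle A_iB_j|\phi_+\rangle\|\le f_{ij}(\varepsilon,n),\qquad \|\Phi(A_i'|\psi'\rangle|00\rangle)-|\varphi\rangle A_i|\phi_+\rangle\|\le f_{A_i}(\varepsilon,n),$$ $$\|\Phi(B_j'|\psi'\rangle|00\rangle)-|\varphi\rangle B_j|\phi_+\rangle\|\le f_{B_j}(\varepsilon,n),\qquad \|\Phi(|\psi'\rangle|00\rangle)-|\varphi\rangle|\phi_+\rangle\|\le f(\varepsilon,n).$$ For each $n$ these functions tend to $0$ as $\varepsilon\to0^+$, and there are absolute constants $0<c\le C$ such that each of them lies between $c\,n^2\sqrt\varepsilon$ and $C\,n^2\sqrt\varepsilon$ for all $n\ge2$, $\varepsilon\ge0$ and all $i,j\in\{1,\dots,n\}$. For even $n$ the functions are explicit. With $\varepsilon_1=\varepsilon/\cos\frac\pi{2n}$, $\varepsilon_2=8\varepsilon\cos\frac\pi{2n}$, $\xi_m=2\cos\frac{(2m+1)\pi}{2n}$ and, for $1\le m\le n-2$, $$\alpha_m=\frac{\sin(\pi/n)}{2\cos(\pi/2n)}\Bigl(\sin\tfrac{m\pi}n\sin\tfrac{(m+1)\pi}n\Bigr)^{-1/2},\qquad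 \gamma_m=\frac1{2\cos(\pi/2n)}\Bigl(\sin\tfrac{m\pi}n\big/\sin\tfrac{(m+1)\pi}n\Bigr)^{1/2},$$ put $$\omega=\sqrt{2\varepsilon_1}+\frac1{\xi_{n/2-1}}\Bigl(\frac{4\sqrt{\varepsilon_1}}{\alpha_{n/2-1}}+n\sqrt{2\varepsilon_2}\Bigr),\qquad \delta=\bigl(\tfrac12+\sqrt2\bigr)\sqrt{\varepsilon_1}+\omega$$ (without the term $4\sqrt{\varepsilon_1}/\alpha_{n/2-1}$ for $n=2$). Put $g_i=0$ for $i\in\{1,\frac n2+1\}$ and otherwise $g_i=\bigl(1+\frac{\gamma_m}{2\alpha_1}\bigr)\frac{\sqrt{\varepsilon_1}}{\alpha_m}+r_i$ with $m=|\frac n2+1-i|$, where $r_i=\bigl(1+\frac{\gamma_{i-1}}{2\alpha_1}\bigr)\frac{\sqrt{\varepsilon_1}}{\alpha_{i-1}}$ for $i<n$ and $r_n=\frac12\sqrt{\varepsilon_1/\alpha_1}$. Put $h_j=\sqrt{\varepsilon_1}\,(p_j+q_j)$ with $p_j=0$ for $j\in\{1,n\}$ and $p_j=1/\alpha_{j-1}$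 otherwise, and $q_j=0$ for $j\in\{\frac n2,\frac n2+1\}$, $q_j=1/\alpha_{n/2-j}$ for $j<\frac n2$, $q_j=1/\alpha_{j-1-n/2}$ for $j>\frac n2+1$. Then $$f=6\sqrt{\varepsilon_1}+\omega+\delta,\quad f_{A_i}=12\sqrt{\varepsilon_1}+3\omega+g_i+\delta,\quad f_{B_j}=13\sqrt{\varepsilon_1}+3\omega+h_j+\delta,\quad f_{ij}=28\sqrt{\varepsilon_1}+6\omega+g_i+h_j+\delta .$$ -/

import Mathlib

open scoped TensorProduct Kronecker Topology

noncomputable section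

namespace ChainedBell

/-! ### Regularised operators -/

section Regularisation

variable {E : Type*} [NormedAddCommGroup E] [InnerProductSpace ℂ E] [CompleteSpace E]

instance hasOrthogonalProjection_ker (T : E →L[ℂ] E) :
    (LinearMap.ker (T : E →ₗ[ℂ] E)).HasOrthogonalProjection :=
  haveI : CompleteSpace (LinearMap.ker (T : E →ₗ[ℂ] E)) :=
    (ContinuousLinearMap.isClosed_ker T).completeSpace_coe
  inferInstance

/-- The orthogonal projector onto the kernel of `M`. -/
def kerProj (M : E →L[ℂ] E) : E →L[ℂ] E :=
  (LinearMap.ker (M : E →ₗ[ℂ] E)).starProjection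

/-- The regularised version of a self-adjoint operator `M`: its zero eigenvalue is replaced by
one and the result is divided by its modulus, i.e. `(M + P) / |M + P|` with `P` the projector onto
the kernel of `M`. It is written here as the operator that is `1` on the subspace on which
`|M| = M` and `-1` on its orthogonal complement; `regularize_unitary`, `regularize_mul_abs` and
`regularize_unique` below say that this is the unitary `U` with `U |M + P| = M + P`. -/
def regularize (M : E →L[ℂ] E) : E →L[ℂ] E :=
  ((LinearMap.ker ((CFC.abs M - M : E →L[ℂ] E) : E →ₗ[ℂ] E)).reflection :
    E →L[ℂ] E)

theorem regularize_unitary (M : E →L[ℂ] E) : regularize M ∈ unitary (E →L[ℂ] E) := by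
  set K := LinearMap.ker ((CFC.abs M - M : E →L[ℂ] E) : E →ₗ[ℂ] E)
  have h2 : regularize M * regularize M = 1 := by
    ext x
    exact K.reflection_reflection x
  have hs : star (regularize M) = regularize M := by
    rw [ContinuousLinearMap.star_eq_adjoint]
    symm
    rw [ContinuousLinearMap.eq_adjoint_iff]
    intro x y
    have := K.reflection.inner_map_map x (K.reflection y)
    rw [K.reflection_reflection] at this
    exact this
  rw [Unitary.mem_iff, hs]
  exact ⟨h2, h2⟩

theorem kerProj_apply_of_mem {M : E →L[ℂ] E} {x : E} (hx : M x = 0) : kerProj M x = x :=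
  Submodule.starProjection_eq_self_iff.2 (by simpa using hx)

theorem apply_kerProj (M : E →L[ℂ] E) (x : E) : M (kerProj M x) = 0 :=
  LinearMap.mem_ker.1 (Submodule.starProjection_apply_mem (LinearMap.ker (M : E →ₗ[ℂ] E)) x)

theorem abs_apply_of_mem {M : E →L[ℂ] E} {x : E} (hx : M x = 0) : CFC.abs M x = 0 := by
  have hsa : IsSelfAdjoint (CFC.abs M) := (CFC.abs_nonneg M).isSelfAdjoint
  have h : inner ℂ (CFC.abs M x) (CFC.abs M x) = (0 : ℂ) := by
    have h1 : CFC.abs M (CFC.abs M x) = star M (M x) :=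
      congrArg (fun T : E →L[ℂ] E => T x) (CFC.abs_mul_abs M)
    have h2 := ContinuousLinearMap.adjoint_inner_left (CFC.abs M) x (CFC.abs M x)
    rw [← ContinuousLinearMap.star_eq_adjoint, hsa.star_eq] at h2
    rw [← h2, h1, hx]
    simp
  simpa using h

theorem isSelfAdjoint_kerProj (M : E →L[ℂ] E) : IsSelfAdjoint (kerProj M) :=
  isSelfAdjoint_starProjection _

theorem kerProj_mul_self (M : E →L[ℂ] E) : kerProj M * kerProj M = kerProj M :=
  Submodule.isIdempotentElem_starProjection _

theorem mul_kerProj (M : E →L[ℂ] E) : M * kerProj M = 0 := by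
  ext x
  exact apply_kerProj M x

theorem abs_mul_kerProj (M : E →L[ℂ] E) : CFC.abs M * kerProj M = 0 := by
  ext x
  exact abs_apply_of_mem (apply_kerProj M x)

theorem kerProj_mul {M T : E →L[ℂ] E} (hT : IsSelfAdjoint T) (h : T * kerProj M = 0) :
    kerProj M * T = 0 := by
  have := congrArg star h
  rwa [star_mul, hT.star_eq, (isSelfAdjoint_kerProj M).star_eq, star_zero] at this

theorem abs_add_kerProj {M : E →L[ℂ] E} (hM : IsSelfAdjoint M) :
    CFC.abs (M + kerProj M) = CFC.abs M + kerProj M := by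
  have hsa : IsSelfAdjoint (CFC.abs M) := (CFC.abs_nonneg M).isSelfAdjoint
  have hP : 0 ≤ kerProj M := by
    have := star_mul_self_nonneg (kerProj M)
    rwa [(isSelfAdjoint_kerProj M).star_eq, kerProj_mul_self] at this
  refine CFC.sqrt_unique ?_ (add_nonneg (CFC.abs_nonneg M) hP)
  rw [(hM.add (isSelfAdjoint_kerProj M)).star_eq]
  simp only [mul_add, add_mul, mul_kerProj, abs_mul_kerProj, kerProj_mul hM (mul_kerProj M),
    kerProj_mul hsa (abs_mul_kerProj M), CFC.abs_mul_abs, hM.star_eq]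

theorem regularize_mul_abs {M : E →L[ℂ] E} (hM : IsSelfAdjoint M) :
    regularize M * CFC.abs (M + kerProj M) = M + kerProj M := by
  have hsa : IsSelfAdjoint (CFC.abs M) := (CFC.abs_nonneg M).isSelfAdjoint
  have hcomm : Commute (CFC.abs M) M := CFC.commute_abs_self M hM.isStarNormal
  set K := LinearMap.ker ((CFC.abs M - M : E →L[ℂ] E) : E →ₗ[ℂ] E) with hK
  have hmul : (CFC.abs M - M) * (CFC.abs M + M) = 0 := by
    have h1 := CFC.abs_mul_abs M
    rw [hM.star_eq] at h1
    rw [sub_mul, mul_add, mul_add, h1, hcomm.eq]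
    abel
  rw [abs_add_kerProj hM]
  ext x
  have hp : (CFC.abs M + M) x ∈ K := by
    have := congrArg (fun T : E →L[ℂ] E => T x) hmul
    simpa [hK] using this
  have hn : (CFC.abs M - M) x ∈ Kᗮ := by
    rw [Submodule.mem_orthogonal]
    intro k hk
    have hk' : (CFC.abs M - M) k = 0 := by simpa [hK] using hk
    have h2 := ContinuousLinearMap.adjoint_inner_left (CFC.abs M - M) x k
    rw [← ContinuousLinearMap.star_eq_adjoint, (hsa.sub hM).star_eq, hk'] at h2
    rw [← h2, inner_zero_left]
  have hq : kerProj M x ∈ K := by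
    have h1 := apply_kerProj M x
    have h2 := abs_apply_of_mem h1
    simp [hK, h1, h2]
  have e1 : K.reflection ((CFC.abs M + M) x) = (CFC.abs M + M) x :=
    Submodule.reflection_mem_subspace_eq_self hp
  have e2 : K.reflection ((CFC.abs M - M) x) = -(CFC.abs M - M) x :=
    Submodule.reflection_mem_subspace_orthogonalComplement_eq_neg hn
  have e3 : K.reflection (kerProj M x) = kerProj M x :=
    Submodule.reflection_mem_subspace_eq_self hq
  have hsplit : CFC.abs M x =
      (2⁻¹ : ℂ) • ((CFC.abs M + M) x + (CFC.abs M - M) x) := by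
    simp only [add_apply, sub_apply]
    module
  change K.reflection ((CFC.abs M + kerProj M) x) = (M + kerProj M) x
  rw [add_apply, map_add, e3, hsplit, map_smul, map_add, e1, e2]
  simp only [add_apply, sub_apply]
  module

theorem regularize_unique {M : E →L[ℂ] E} (hM : IsSelfAdjoint M) {V : E →L[ℂ] E}
    (hV : V * CFC.abs (M + kerProj M) = M + kerProj M) : V = regularize M := by
  set T := CFC.abs (M + kerProj M) with hT
  have hTsa : IsSelfAdjoint T := (CFC.abs_nonneg _).isSelfAdjoint
  have hinj : ∀ x, T x = 0 → x = 0 := by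
    intro x hx
    have h1 : (M + kerProj M) x = 0 := by
      rw [← hV]
      simp [hx]
    have h2 : (kerProj M * (M + kerProj M)) x = 0 := by
      change kerProj M ((M + kerProj M) x) = 0
      rw [h1, map_zero]
    rw [mul_add, kerProj_mul hM (mul_kerProj M), kerProj_mul_self, zero_add] at h2
    have h3 : M x = 0 := by simpa [h2] using h1
    rw [← kerProj_apply_of_mem h3, h2]
  have hz : T * star (V - regularize M) = 0 := by
    have : (V - regularize M) * T = 0 := by
      rw [sub_mul, hV, regularize_mul_abs hM, sub_self]
    have := congrArg star this
    rwa [star_mul, hTsa.star_eq, star_zero] at this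
  have hz' : star (V - regularize M) = 0 := by
    ext x
    exact hinj _ (congrArg (fun S : E →L[ℂ] E => S x) hz)
  exact sub_eq_zero.1 (star_eq_zero.1 hz')

end Regularisation

/-! ### The physical experiment -/

/-- A `±1`-valued observable: a Hermitian operator with square one, that is, one for which
`(1 ± T) / 2` are projectors. -/
def IsBinaryObservable {E : Type*} [NormedAddCommGroup E] [InnerProductSpace ℂ E]
    [CompleteSpace E] (T : E →L[ℂ] E) : Prop :=
  IsSelfAdjoint T ∧ T * T = 1

section Physical

variable (HA HB : Type*) [NormedAddCommGroup HA] [InnerProductSpace ℂ HA]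
  [NormedAddCommGroup HB] [InnerProductSpace ℂ HB]

/-- The Hilbert space tensor product of `HA` and `HB`. -/
abbrev Joint : Type _ := UniformSpace.Completion (HA ⊗[ℂ] HB)

variable {HA HB}

/-- The operator `S ⊗ T` on the Hilbert space tensor product. -/
def tensorOp (S : HA →L[ℂ] HA) (T : HB →L[ℂ] HB) : Joint HA HB →L[ℂ] Joint HA HB :=
  (TensorProduct.mapL S T).completion

/-- `S` acting on Alice's part. -/
def onA (S : HA →L[ℂ] HA) : Joint HA HB →L[ℂ] Joint HA HB := tensorOp S 1

/-- `T` acting on Bob's part. -/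
def onB (T : HB →L[ℂ] HB) : Joint HA HB →L[ℂ] Joint HA HB := tensorOp 1 T

/-- The observables `A 1, …, A n` continued by `A (n + 1) = -A 1`. -/
def wrap (n : ℕ) (A : ℕ → HA →L[ℂ] HA) (i : ℕ) : HA →L[ℂ] HA :=
  if i = n + 1 then -A 1 else A i

/-- The Bell operator `∑_{i=1}^n (A_i ⊗ B_i + A_{i+1} ⊗ B_i)` with `A_{n+1} = -A_1`. -/
def bellOp (n : ℕ) (A : ℕ → HA →L[ℂ] HA) (B : ℕ → HB →L[ℂ] HB) :
    Joint HA HB →L[ℂ] Joint HA HB :=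
  ∑ i ∈ Finset.Icc 1 n, (tensorOp (A i) (B i) + tensorOp (wrap n A (i + 1)) (B i))

/-- The value `⟨ψ| 𝓑 |ψ⟩` of the chained Bell expression. -/
def bellValue (n : ℕ) (A : ℕ → HA →L[ℂ] HA) (B : ℕ → HB →L[ℂ] HB) (ψ : Joint HA HB) : ℂ :=
  inner ℂ ψ (bellOp n A B ψ)

/-- The maximal quantum value `2 n cos (π / 2n)`. -/
def bellMax (n : ℕ) : ℝ := 2 * n * Real.cos (Real.pi / (2 * n))

/-- `X_A'`. -/
def XA (n : ℕ) (A : ℕ → HA →L[ℂ] HA) : HA →L[ℂ] HA :=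
  if Even n then A (n / 2 + 1)
  else (((2 * Real.cos (Real.pi / (2 * n)))⁻¹ : ℝ) : ℂ) • (A ((n + 1) / 2) + A ((n + 3) / 2))

/-- `Z_A'`. -/
def ZA (A : ℕ → HA →L[ℂ] HA) : HA →L[ℂ] HA := A 1

/-- `X_B'`. -/
def XB (n : ℕ) (B : ℕ → HB →L[ℂ] HB) : HB →L[ℂ] HB :=
  if Even n then (((2 * Real.cos (Real.pi / (2 * n)))⁻¹ : ℝ) : ℂ) • (B (n / 2) + B (n / 2 + 1))
  else B ((n + 1) / 2)

/-- `Z_B'`. -/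
def ZB (n : ℕ) (B : ℕ → HB →L[ℂ] HB) : HB →L[ℂ] HB :=
  (((2 * Real.cos (Real.pi / (2 * n)))⁻¹ : ℝ) : ℂ) • (B 1 - B n)

end Physical

/-! ### The swap circuit -/

section Circuit

variable (H : Type*) [NormedAddCommGroup H] [InnerProductSpace ℂ H]

/-- The Hilbert space `H ⊗ ℂ² ⊗ ℂ²`: a vector is written `∑_{a,b} v (a, b) ⊗ |a b⟩`, with `a` for
Alice's ancilla qubit and `b` for Bob's. -/
abbrev WithAncillas : Type _ := PiLp 2 (fun _ : Fin 2 × Fin 2 => H)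

variable {H}

/-- The product vector `|φ⟩ ⊗ |v⟩` of `φ` in `H` and a two-qubit vector `v`. -/
def prodVec (φ : H) (v : Fin 2 × Fin 2 → ℂ) : WithAncillas H :=
  WithLp.toLp 2 fun k => v k • φ

/-- The two-qubit vector `|00⟩`. -/
def ket00 : Fin 2 × Fin 2 → ℂ := fun k => if k = (0, 0) then 1 else 0

/-- A two-qubit gate on the ancillas. -/
def ancGate (M : Matrix (Fin 2 × Fin 2) (Fin 2 × Fin 2) ℂ) (v : WithAncillas H) :
    WithAncillas H :=
  WithLp.toLp 2 fun k => ∑ l, M k l • v l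

/-- The Hadamard gate. -/
def hadamard : Matrix (Fin 2) (Fin 2) ℂ := ((1 / √2 : ℝ) : ℂ) • !![1, 1; 1, -1]

/-- The gate `U` on `H` controlled by Alice's ancilla. -/
def ctrlA (U : H →L[ℂ] H) (v : WithAncillas H) : WithAncillas H :=
  WithLp.toLp 2 fun k => if k.1 = 1 then U (v k) else v k

/-- The gate `U` on `H` controlled by Bob's ancilla. -/
def ctrlB (U : H →L[ℂ] H) (v : WithAncillas H) : WithAncillas H :=
  WithLp.toLp 2 fun k => if k.2 = 1 then U (v k) else v k

/-- Alice's half of the swap circuit: Hadamard, controlled `Z`, Hadamard, controlled `X`. -/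
def circuitA (X Z : H →L[ℂ] H) (v : WithAncillas H) : WithAncillas H :=
  ctrlA X (ancGate (hadamard ⊗ₖ 1) (ctrlA Z (ancGate (hadamard ⊗ₖ 1) v)))

/-- Bob's half of the swap circuit. -/
def circuitB (X Z : H →L[ℂ] H) (v : WithAncillas H) : WithAncillas H :=
  ctrlB X (ancGate (1 ⊗ₖ hadamard) (ctrlB Z (ancGate (1 ⊗ₖ hadamard) v)))

end Circuit

section Isometry

variable {HA HB : Type*} [NormedAddCommGroup HA] [InnerProductSpace ℂ HA] [CompleteSpace HA]
  [NormedAddCommGroup HB] [InnerProductSpace ℂ HB] [CompleteSpace HB]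

/-- The unitary `Φ`: the swap circuit with the regularised operators. -/
def Phi (n : ℕ) (A : ℕ → HA →L[ℂ] HA) (B : ℕ → HB →L[ℂ] HB)
    (v : WithAncillas (Joint HA HB)) : WithAncillas (Joint HA HB) :=
  circuitA (onA (regularize (XA n A))) (onA (regularize (ZA A)))
    (circuitB (onB (regularize (XB n B))) (onB (regularize (ZB n B))) v)

/-- The vector `(1 + Z_A') (1 + Z̃_B) |ψ'⟩`. -/
def junkUnnormalized (n : ℕ) (A : ℕ → HA →L[ℂ] HA) (B : ℕ → HB →L[ℂ] HB)
    (ψ : Joint HA HB) : Joint HA HB :=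
  onA (1 + ZA A) (onB (1 + regularize (ZB n B)) ψ)

/-- The vector `|φ⟩`: the previous one divided by its length. -/
def junk (n : ℕ) (A : ℕ → HA →L[ℂ] HA) (B : ℕ → HB →L[ℂ] HB)
    (ψ : Joint HA HB) : Joint HA HB :=
  ((‖junkUnnormalized n A B ψ‖⁻¹ : ℝ) : ℂ) • junkUnnormalized n A B ψ

end Isometry

/-! ### The reference experiment -/

/-- The maximally entangled two-qubit state `(|00⟩ + |11⟩) / √2`. -/
def phiPlus : Fin 2 × Fin 2 → ℂ := fun k => if k.1 = k.2 then ((1 / √2 : ℝ) : ℂ) else 0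

/-- `sin t • X + cos t • Z` with the Pauli matrices `X` and `Z`. -/
def pauliXZ (t : ℝ) : Matrix (Fin 2) (Fin 2) ℂ :=
  (Real.sin t : ℂ) • !![0, 1; 1, 0] + (Real.cos t : ℂ) • !![1, 0; 0, -1]

/-- The reference observable `A_i`, at the angle `(i - 1) π / n`. -/
def refA (n i : ℕ) : Matrix (Fin 2) (Fin 2) ℂ := pauliXZ (((i : ℝ) - 1) * Real.pi / n)

/-- The reference observable `B_j`, at the angle `(2 j - 1) π / 2n`. -/
def refB (n j : ℕ) : Matrix (Fin 2) (Fin 2) ℂ := pauliXZ ((2 * (j : ℝ) - 1) * Real.pi / (2 * n))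

/-! ### The explicit error bounds for an even number of measurements -/

/-- `ε₁ = ε / cos (π / 2n)`. -/
def eps1 (ε : ℝ) (n : ℕ) : ℝ := ε / Real.cos (Real.pi / (2 * n))

/-- `ε₂ = 8 ε cos (π / 2n)`. -/
def eps2 (ε : ℝ) (n : ℕ) : ℝ := 8 * Real.cos (Real.pi / (2 * n)) * ε

/-- `α_m`, meaningful for `1 ≤ m ≤ n - 2`. -/
def alpha (n m : ℕ) : ℝ :=
  Real.sin (Real.pi / n) / (2 * Real.cos (Real.pi / (2 * n))) *
    √(1 / (Real.sin (Real.pi * m / n) * Real.sin (Real.pi * (m + 1) / n)))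

/-- `γ_m`, meaningful for `1 ≤ m ≤ n - 2`. -/
def gamma (n m : ℕ) : ℝ :=
  1 / (2 * Real.cos (Real.pi / (2 * n))) *
    √(Real.sin (Real.pi * m / n) / Real.sin (Real.pi * (m + 1) / n))

/-- `ξ_m = 2 cos ((2m + 1) π / 2n)`. -/
def xi (n m : ℕ) : ℝ := 2 * Real.cos ((2 * m + 1) * Real.pi / (2 * n))

/-- The bound on the anticommutator of `X_A'` and `Z_A'`; for `n = 2` the term with
`1 / α_{n/2-1}` is absent. -/
def omegaEv (ε : ℝ) (n : ℕ) : ℝ :=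
  √(2 * eps1 ε n) + 1 / xi n (n / 2 - 1) *
    ((if n = 2 then 0 else 4 * √(eps1 ε n) / alpha n (n / 2 - 1)) + n * √(2 * eps2 ε n))

/-- The bound `g` for Alice's `i`-th observable, with `|n/2 + 1 - i|` as an index. -/
def gEv (ε : ℝ) (n i : ℕ) : ℝ :=
  if i = 1 ∨ i = n / 2 + 1 then 0
  else (1 + gamma n (Nat.dist (n / 2 + 1) i) / (2 * alpha n 1)) *
      (√(eps1 ε n) / alpha n (Nat.dist (n / 2 + 1) i)) +
    (if i = n then √(eps1 ε n / alpha n 1) / 2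
      else (1 + gamma n (i - 1) / (2 * alpha n 1)) * (√(eps1 ε n) / alpha n (i - 1)))

/-- The bound `h` for Bob's `j`-th observable. -/
def hEv (ε : ℝ) (n j : ℕ) : ℝ :=
  √(eps1 ε n) *
    ((if j = 1 ∨ j = n then 0 else 1 / alpha n (j - 1)) +
      (if j = n / 2 ∨ j = n / 2 + 1 then 0
        else if j < n / 2 then 1 / alpha n (n / 2 - j) else 1 / alpha n (j - 1 - n / 2)))

/-- The error made by normalising the vector `|φ'⟩`. -/
def normErr (ε : ℝ) (n : ℕ) : ℝ := (1 / 2 + √2) * √(eps1 ε n) + omegaEv ε n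

/-- The bound for `|ψ'⟩`, `n` even. -/
def boundEv (ε : ℝ) (n : ℕ) : ℝ := 6 * √(eps1 ε n) + omegaEv ε n + normErr ε n

/-- The bound for `A_i' |ψ'⟩`, `n` even. -/
def boundEvA (i : ℕ) (ε : ℝ) (n : ℕ) : ℝ :=
  12 * √(eps1 ε n) + 3 * omegaEv ε n + gEv ε n i + normErr ε n

/-- The bound for `B_j' |ψ'⟩`, `n` even. -/
def boundEvB (j : ℕ) (ε : ℝ) (n : ℕ) : ℝ :=
  13 * √(eps1 ε n) + 3 * omegaEv ε n + hEv ε n j + normErr ε n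

/-- The bound for `A_i' B_j' |ψ'⟩`, `n` even. -/
def boundEvAB (i j : ℕ) (ε : ℝ) (n : ℕ) : ℝ :=
  28 * √(eps1 ε n) + 6 * omegaEv ε n + gEv ε n i + hEv ε n j + normErr ε n

end ChainedBell

end

noncomputable section

namespace ChainedBell

section TensorOperators

variable {HA HB : Type*} [NormedAddCommGroup HA] [InnerProductSpace ℂ HA]
  [NormedAddCommGroup HB] [InnerProductSpace ℂ HB]

theorem tensorOp_coe (S : HA →L[ℂ] HA) (T : HB →L[ℂ] HB) (x : HA ⊗[ℂ] HB) :
    tensorOp S T (x : Joint HA HB) = ((TensorProduct.mapL S T x : HA ⊗[ℂ] HB) : Joint HA HB) :=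
  ContinuousLinearMap.completion_apply_coe _ _

theorem joint_ext {P Q : Joint HA HB →L[ℂ] Joint HA HB}
    (h : ∀ x : HA ⊗[ℂ] HB, P (x : Joint HA HB) = Q (x : Joint HA HB)) : P = Q := by
  ext v
  induction v using UniformSpace.Completion.induction_on with
  | hp => exact isClosed_eq P.continuous Q.continuous
  | ih x => exact h x

theorem tensorOp_mul (S S' : HA →L[ℂ] HA) (T T' : HB →L[ℂ] HB) :
    tensorOp (S * S') (T * T') = tensorOp S T * tensorOp S' T' := by
  refine joint_ext fun x => ?_
  rw [mul_apply_eq_comp, tensorOp_coe, tensorOp_coe, tensorOp_coe,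
    TensorProduct.mapL_mul, mul_apply_eq_comp]

theorem tensorOp_add_left (S S' : HA →L[ℂ] HA) (T : HB →L[ℂ] HB) :
    tensorOp (S + S') T = tensorOp S T + tensorOp S' T := by
  refine joint_ext fun x => ?_
  rw [add_apply, tensorOp_coe, tensorOp_coe, tensorOp_coe,
    TensorProduct.mapL_add_left, add_apply, UniformSpace.Completion.coe_add]

theorem tensorOp_add_right (S : HA →L[ℂ] HA) (T T' : HB →L[ℂ] HB) :
    tensorOp S (T + T') = tensorOp S T + tensorOp S T' := by
  refine joint_ext fun x => ?_
  rw [add_apply, tensorOp_coe, tensorOp_coe, tensorOp_coe,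
    TensorProduct.mapL_add_right, add_apply, UniformSpace.Completion.coe_add]

theorem tensorOp_smul_left (r : ℂ) (S : HA →L[ℂ] HA) (T : HB →L[ℂ] HB) :
    tensorOp (r • S) T = r • tensorOp S T := by
  refine joint_ext fun x => ?_
  rw [smul_apply, tensorOp_coe, tensorOp_coe,
    TensorProduct.mapL_smul_left, smul_apply, UniformSpace.Completion.coe_smul]

theorem tensorOp_smul_right (r : ℂ) (S : HA →L[ℂ] HA) (T : HB →L[ℂ] HB) :
    tensorOp S (r • T) = r • tensorOp S T := by
  refine joint_ext fun x => ?_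
  rw [smul_apply, tensorOp_coe, tensorOp_coe,
    TensorProduct.mapL_smul_right, smul_apply, UniformSpace.Completion.coe_smul]

theorem tensorOp_one : tensorOp (1 : HA →L[ℂ] HA) (1 : HB →L[ℂ] HB) = 1 := by
  refine joint_ext fun x => ?_
  rw [tensorOp_coe]
  change ((TensorProduct.mapL (.id ℂ HA) (.id ℂ HB) x : HA ⊗[ℂ] HB) : Joint HA HB) = _
  rw [TensorProduct.mapL_id_id]
  rfl

theorem inner_tensorOp [CompleteSpace HA] [CompleteSpace HB] {S : HA →L[ℂ] HA}
    {T : HB →L[ℂ] HB} (hS : IsSelfAdjoint S) (hT : IsSelfAdjoint T) (v w : Joint HA HB) :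
    inner ℂ (tensorOp S T v) w = inner ℂ v (tensorOp S T w) := by
  induction v, w using UniformSpace.Completion.induction_on₂ with
  | hp => exact isClosed_eq (by fun_prop) (by fun_prop)
  | ih x y =>
    rw [tensorOp_coe, tensorOp_coe, UniformSpace.Completion.inner_coe,
      UniformSpace.Completion.inner_coe]
    induction x using TensorProduct.induction_on with
    | zero => simp
    | add x x' hx hx' => rw [map_add, inner_add_left, inner_add_left, hx, hx']
    | tmul a b =>
      induction y using TensorProduct.induction_on with
      | zero => simp
      | add y y' hy hy' => rw [map_add, inner_add_right, inner_add_right, hy, hy']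
      | tmul a' b' =>
        have h1 := ContinuousLinearMap.adjoint_inner_left S a' a
        have h2 := ContinuousLinearMap.adjoint_inner_left T b' b
        rw [← ContinuousLinearMap.star_eq_adjoint, hS.star_eq] at h1
        rw [← ContinuousLinearMap.star_eq_adjoint, hT.star_eq] at h2
        rw [TensorProduct.mapL_tmul, TensorProduct.mapL_tmul, TensorProduct.inner_tmul,
          TensorProduct.inner_tmul, h1, h2]

theorem isSelfAdjoint_tensorOp [CompleteSpace HA] [CompleteSpace HB] {S : HA →L[ℂ] HA}
    {T : HB →L[ℂ] HB} (hS : IsSelfAdjoint S) (hT : IsSelfAdjoint T) :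
    IsSelfAdjoint (tensorOp S T : Joint HA HB →L[ℂ] Joint HA HB) := by
  rw [ContinuousLinearMap.isSelfAdjoint_iff_isSymmetric]
  exact fun v w => inner_tensorOp hS hT v w

theorem onA_mul_onB (S : HA →L[ℂ] HA) (T : HB →L[ℂ] HB) :
    onA S * onB T = tensorOp S T := by
  rw [onA, onB, ← tensorOp_mul, one_mul, mul_one]

theorem commute_onA_onB (S : HA →L[ℂ] HA) (T : HB →L[ℂ] HB) :
    Commute (onA S : Joint HA HB →L[ℂ] Joint HA HB) (onB T) := by
  rw [Commute, SemiconjBy, onA_mul_onB, onA, onB, ← tensorOp_mul, one_mul, mul_one]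

theorem onA_mul (S S' : HA →L[ℂ] HA) :
    (onA (S * S') : Joint HA HB →L[ℂ] Joint HA HB) = onA S * onA S' := by
  rw [onA, onA, onA, ← tensorOp_mul, one_mul]

theorem onB_mul (T T' : HB →L[ℂ] HB) :
    (onB (T * T') : Joint HA HB →L[ℂ] Joint HA HB) = onB T * onB T' := by
  rw [onB, onB, onB, ← tensorOp_mul, one_mul]

theorem onA_one : (onA 1 : Joint HA HB →L[ℂ] Joint HA HB) = 1 := tensorOp_one

theorem onB_one : (onB 1 : Joint HA HB →L[ℂ] Joint HA HB) = 1 := tensorOp_one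

theorem onA_add (S S' : HA →L[ℂ] HA) :
    (onA (S + S') : Joint HA HB →L[ℂ] Joint HA HB) = onA S + onA S' := tensorOp_add_left _ _ _

theorem onB_add (T T' : HB →L[ℂ] HB) :
    (onB (T + T') : Joint HA HB →L[ℂ] Joint HA HB) = onB T + onB T' := tensorOp_add_right _ _ _

theorem onA_smul (r : ℂ) (S : HA →L[ℂ] HA) :
    (onA (r • S) : Joint HA HB →L[ℂ] Joint HA HB) = r • onA S := tensorOp_smul_left _ _ _

theorem onB_smul (r : ℂ) (T : HB →L[ℂ] HB) :
    (onB (r • T) : Joint HA HB →L[ℂ] Joint HA HB) = r • onB T := tensorOp_smul_right _ _ _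

theorem onA_neg (S : HA →L[ℂ] HA) :
    (onA (-S) : Joint HA HB →L[ℂ] Joint HA HB) = -onA S := by
  rw [← neg_one_smul ℂ, onA_smul, neg_one_smul]

theorem onB_sub (T T' : HB →L[ℂ] HB) :
    (onB (T - T') : Joint HA HB →L[ℂ] Joint HA HB) = onB T - onB T' := by
  rw [sub_eq_add_neg, ← neg_one_smul ℂ, onB_add, onB_smul, neg_one_smul, ← sub_eq_add_neg]

variable [CompleteSpace HA] [CompleteSpace HB]

theorem IsBinaryObservable.onA {S : HA →L[ℂ] HA} (hS : IsBinaryObservable S) :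
    IsBinaryObservable (onA S : Joint HA HB →L[ℂ] Joint HA HB) :=
  ⟨isSelfAdjoint_tensorOp hS.1 (IsSelfAdjoint.one _), by rw [← onA_mul, hS.2, onA_one]⟩

theorem IsBinaryObservable.onB {T : HB →L[ℂ] HB} (hT : IsBinaryObservable T) :
    IsBinaryObservable (onB T : Joint HA HB →L[ℂ] Joint HA HB) :=
  ⟨isSelfAdjoint_tensorOp (IsSelfAdjoint.one _) hT.1, by rw [← onB_mul, hT.2, onB_one]⟩

end TensorOperators

section Observables

variable {E : Type*} [NormedAddCommGroup E] [InnerProductSpace ℂ E] [CompleteSpace E]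

theorem inner_apply_of_isSelfAdjoint {T : E →L[ℂ] E} (hT : IsSelfAdjoint T) (x y : E) :
    inner ℂ (T x) y = inner ℂ x (T y) := by
  have h := ContinuousLinearMap.adjoint_inner_left T y x
  rwa [← ContinuousLinearMap.star_eq_adjoint, hT.star_eq] at h

theorem IsBinaryObservable.apply_apply {T : E →L[ℂ] E} (hT : IsBinaryObservable T) (x : E) :
    T (T x) = x :=
  congrArg (fun S : E →L[ℂ] E => S x) hT.2

theorem IsBinaryObservable.norm_apply {T : E →L[ℂ] E} (hT : IsBinaryObservable T) (x : E) :
    ‖T x‖ = ‖x‖ := by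
  have h : (inner ℂ (T x) (T x) : ℂ) = inner ℂ x x := by
    rw [inner_apply_of_isSelfAdjoint hT.1, hT.apply_apply]
  rw [inner_self_eq_norm_sq_to_K, inner_self_eq_norm_sq_to_K] at h
  have h' : ‖T x‖ ^ 2 = ‖x‖ ^ 2 := by exact_mod_cast h
  exact (sq_eq_sq₀ (norm_nonneg _) (norm_nonneg _)).1 h'

theorem isBinaryObservable_regularize (M : E →L[ℂ] E) : IsBinaryObservable (regularize M) := by
  have h2 : regularize M * regularize M = 1 := by
    ext x
    exact (LinearMap.ker ((CFC.abs M - M : E →L[ℂ] E) : E →ₗ[ℂ] E)).reflection_reflection x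
  refine ⟨?_, h2⟩
  have h3 := (Unitary.mem_iff.1 (regularize_unitary M)).1
  calc star (regularize M) = star (regularize M) * (regularize M * regularize M) := by
        rw [h2, mul_one]
    _ = regularize M := by rw [← mul_assoc, h3, one_mul]

theorem regularize_eq_self {M : E →L[ℂ] E} (hM : IsBinaryObservable M) : regularize M = M := by
  have hP : kerProj M = 0 := by
    rw [← one_mul (kerProj M), ← hM.2, mul_assoc, mul_kerProj, mul_zero]
  have habs : CFC.abs M = 1 := by
    rw [CFC.abs, hM.1.star_eq, hM.2, CFC.sqrt_one]
  refine (regularize_unique hM.1 ?_).symm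
  rw [hP, add_zero, habs, mul_one]

theorem regularize_mul_abs_self {M : E →L[ℂ] E} (hM : IsSelfAdjoint M) :
    regularize M * CFC.abs M = M := by
  have h := regularize_mul_abs hM
  have hP : regularize M * kerProj M = kerProj M := by
    ext x
    have h1 : M (kerProj M x) = 0 := apply_kerProj M x
    have h2 : CFC.abs M (kerProj M x) = 0 := abs_apply_of_mem h1
    have h3 : kerProj M x ∈ LinearMap.ker ((CFC.abs M - M : E →L[ℂ] E) : E →ₗ[ℂ] E) := by
      rw [LinearMap.mem_ker]
      change CFC.abs M (kerProj M x) - M (kerProj M x) = 0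
      rw [h1, h2, sub_zero]
    have e := Submodule.reflection_mem_subspace_eq_self h3
    rw [mul_apply_eq_comp]
    change (LinearMap.ker ((CFC.abs M - M : E →L[ℂ] E) : E →ₗ[ℂ] E)).reflection (kerProj M x) = _
    rw [e]
  rw [abs_add_kerProj hM, mul_add, hP] at h
  exact add_right_cancel h

end Observables

section RegularizationError

variable {H : Type*} [NormedAddCommGroup H] [InnerProductSpace ℂ H] [CompleteSpace H]

theorem norm_sub_polar_le {U R T : H →L[ℂ] H} (hU : IsBinaryObservable U)
    (hR : IsBinaryObservable R) (hpos : ∀ x, 0 ≤ (inner ℂ x (T x)).re)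
    (hRT : Commute R T) (hUR : Commute U R) (hUT : Commute U T) (ψ : H) :
    ‖R ψ - R (T ψ)‖ ≤ ‖U ψ - R (T ψ)‖ := by
  have hRT' : ∀ x, T (R x) = R (T x) := fun x => (congrArg (fun S : H →L[ℂ] H => S x) hRT.eq).symm
  have hUT' : ∀ x, T (U x) = U (T x) := fun x => (congrArg (fun S : H →L[ℂ] H => S x) hUT.eq).symm
  have hUR' : ∀ x, R (U x) = U (R x) := fun x => (congrArg (fun S : H →L[ℂ] H => S x) hUR.eq).symm
  have hkey : (inner ℂ (U ψ) (R (T ψ))).re ≤ (inner ℂ (R ψ) (R (T ψ))).re := by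
    have h := hpos (ψ - U (R ψ))
    have e1 : (inner ℂ (R ψ) (R (T ψ)) : ℂ) = inner ℂ ψ (T ψ) := by
      rw [inner_apply_of_isSelfAdjoint hR.1, hR.apply_apply]
    have e2 : (inner ℂ (U (R ψ)) (T (U (R ψ))) : ℂ) = inner ℂ ψ (T ψ) := by
      rw [hUT', hRT', inner_apply_of_isSelfAdjoint hU.1, hU.apply_apply, e1]
    have e3 : (inner ℂ (U (R ψ)) (T ψ) : ℂ) = inner ℂ (U ψ) (R (T ψ)) := by
      rw [← hUR', inner_apply_of_isSelfAdjoint hR.1]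
    have e4 : (inner ℂ ψ (T (U (R ψ))) : ℂ) = inner ℂ (U ψ) (R (T ψ)) := by
      rw [hUT', hRT', inner_apply_of_isSelfAdjoint hU.1]
    rw [map_sub, inner_sub_left, inner_sub_right, inner_sub_right, e2, e3, e4] at h
    rw [e1]
    simp only [Complex.sub_re] at h
    linarith
  refine le_of_sq_le_sq ?_ (norm_nonneg _)
  have h1 := norm_sub_sq (𝕜 := ℂ) (R ψ) (R (T ψ))
  have h2 := norm_sub_sq (𝕜 := ℂ) (U ψ) (R (T ψ))
  rw [hR.norm_apply ψ] at h1
  rw [hU.norm_apply ψ] at h2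
  simp only [RCLike.re_to_complex] at h1 h2
  linarith

theorem commute_regularize_abs {M : H →L[ℂ] H} (hM : IsSelfAdjoint M) :
    Commute (regularize M) (CFC.abs M) := by
  have h := regularize_mul_abs_self hM
  have h' := congrArg star h
  rw [star_mul, hM.star_eq, (isBinaryObservable_regularize M).1.star_eq,
    (CFC.abs_nonneg M).isSelfAdjoint.star_eq] at h'
  exact h.trans h'.symm

theorem exists_isSelfAdjoint_mul_self_eq_abs (M : H →L[ℂ] H) :
    ∃ S : H →L[ℂ] H, IsSelfAdjoint S ∧ S * S = CFC.abs M :=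
  ⟨CFC.sqrt (CFC.abs M), (CFC.sqrt_nonneg _).isSelfAdjoint,
    CFC.sqrt_mul_sqrt_self _ (CFC.abs_nonneg M)⟩

variable {HA HB : Type*} [NormedAddCommGroup HA] [InnerProductSpace ℂ HA] [CompleteSpace HA]
  [NormedAddCommGroup HB] [InnerProductSpace ℂ HB] [CompleteSpace HB]

theorem norm_regularize_sub_le_onB {U : HA →L[ℂ] HA} (hU : IsBinaryObservable U)
    {M : HB →L[ℂ] HB} (hM : IsSelfAdjoint M) (ψ : Joint HA HB) :
    ‖onB (regularize M) ψ - onB M ψ‖ ≤ ‖onA U ψ - onB M ψ‖ := by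
  obtain ⟨S, hS, hSS⟩ := exists_isSelfAdjoint_mul_self_eq_abs M
  have hS' : IsSelfAdjoint (onB S : Joint HA HB →L[ℂ] Joint HA HB) :=
    isSelfAdjoint_tensorOp (IsSelfAdjoint.one _) hS
  have h := norm_sub_polar_le (U := onA U) (R := onB (regularize M)) (T := onB (CFC.abs M))
    hU.onA (isBinaryObservable_regularize M).onB
    (fun x => by
      rw [← hSS, onB_mul, mul_apply_eq_comp, ← inner_apply_of_isSelfAdjoint hS']
      exact inner_self_nonneg (𝕜 := ℂ))
    (by rw [Commute, SemiconjBy, ← onB_mul, ← onB_mul, (commute_regularize_abs hM).eq])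
    (commute_onA_onB _ _) (commute_onA_onB _ _) ψ
  rwa [← mul_apply_eq_comp, ← onB_mul, regularize_mul_abs_self hM] at h

theorem norm_regularize_sub_le_onA {U : HB →L[ℂ] HB} (hU : IsBinaryObservable U)
    {M : HA →L[ℂ] HA} (hM : IsSelfAdjoint M) (ψ : Joint HA HB) :
    ‖onA (regularize M) ψ - onA M ψ‖ ≤ ‖onB U ψ - onA M ψ‖ := by
  obtain ⟨S, hS, hSS⟩ := exists_isSelfAdjoint_mul_self_eq_abs M
  have hS' : IsSelfAdjoint (onA S : Joint HA HB →L[ℂ] Joint HA HB) :=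
    isSelfAdjoint_tensorOp hS (IsSelfAdjoint.one _)
  have h := norm_sub_polar_le (U := onB U) (R := onA (regularize M)) (T := onA (CFC.abs M))
    hU.onB (isBinaryObservable_regularize M).onA
    (fun x => by
      rw [← hSS, onA_mul, mul_apply_eq_comp, ← inner_apply_of_isSelfAdjoint hS']
      exact inner_self_nonneg (𝕜 := ℂ))
    (by rw [Commute, SemiconjBy, ← onA_mul, ← onA_mul, (commute_regularize_abs hM).eq])
    (commute_onA_onB _ _).symm (commute_onA_onB _ _).symm ψ
  rwa [← mul_apply_eq_comp, ← onA_mul, regularize_mul_abs_self hM] at h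

end RegularizationError

section Chain

variable {H : Type*} [NormedAddCommGroup H] [InnerProductSpace ℂ H]

/-- The energy of the edge from `x` to `y` of a chain with angle `t` between neighbours. -/
def edgeEnergy (t : ℝ) (x y : H) : ℝ :=
  Real.cos t * ‖x‖ ^ 2 + Real.cos t * ‖y‖ ^ 2 - 2 * (inner ℂ x y).re

theorem edgeEnergy_comm (t : ℝ) (x y : H) : edgeEnergy t x y = edgeEnergy t y x := by
  have h : (inner ℂ x y).re = (inner ℂ y x).re := inner_re_symm (𝕜 := ℂ) x y
  rw [edgeEnergy, edgeEnergy, h]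
  ring

theorem two_mul_re_inner_le (x y : H) {r : ℝ} (hr : 0 < r) :
    2 * (inner ℂ x y).re ≤ r * ‖x‖ ^ 2 + r⁻¹ * ‖y‖ ^ 2 := by
  have h1 : (inner ℂ x y).re ≤ ‖x‖ * ‖y‖ := re_inner_le_norm (𝕜 := ℂ) x y
  have h2 : r * ‖x‖ ^ 2 + r⁻¹ * ‖y‖ ^ 2 - 2 * (‖x‖ * ‖y‖) = r⁻¹ * (r * ‖x‖ - ‖y‖) ^ 2 := by
    field_simp
    ring
  have h3 : 0 ≤ r⁻¹ * (r * ‖x‖ - ‖y‖) ^ 2 := by positivity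
  linarith

/-- The energy of a chain that starts at zero controls its end point. -/
theorem le_sum_edgeEnergy {t : ℝ} (w : ℕ → H) (h0 : w 0 = 0) (m : ℕ) (hm : 1 ≤ m)
    (ht : 0 < t) (hmt : m * t < Real.pi) :
    Real.sin t * Real.cos (m * t) * ‖w m‖ ^ 2 ≤
      Real.sin (m * t) * ∑ k ∈ Finset.range m, edgeEnergy t (w k) (w (k + 1)) := by
  induction m, hm using Nat.le_induction with
  | base => simp [edgeEnergy, h0]; ring_nf; rfl
  | succ m hm ih =>
    push_cast at hmt ⊢
    have hm0 : (1 : ℝ) ≤ m := by exact_mod_cast hm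
    have ih := ih (by nlinarith)
    have hs : 0 < Real.sin (m * t) := Real.sin_pos_of_pos_of_lt_pi (by positivity) (by nlinarith)
    have hs' : 0 < Real.sin ((m + 1) * t) :=
      Real.sin_pos_of_pos_of_lt_pi (by positivity) hmt
    have hadd : Real.sin ((m + 1) * t) =
        Real.sin (m * t) * Real.cos t + Real.cos (m * t) * Real.sin t := by
      rw [add_mul, one_mul, Real.sin_add]
    have cadd : Real.cos ((m + 1) * t) =
        Real.cos (m * t) * Real.cos t - Real.sin (m * t) * Real.sin t := by
      rw [add_mul, one_mul, Real.cos_add]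
    have hpy := Real.sin_sq_add_cos_sq t
    rw [Finset.sum_range_succ]
    set e := ∑ k ∈ Finset.range m, edgeEnergy t (w k) (w (k + 1))
    have hq := two_mul_re_inner_le (w m) (w (m + 1)) (div_pos hs' hs)
    set p := Real.sin (m * t)
    set p' := Real.sin ((m + 1) * t)
    set a := ‖w m‖ ^ 2
    set b := ‖w (m + 1)‖ ^ 2
    have hq' : 2 * (inner ℂ (w m) (w (m + 1))).re * (p * p') ≤ p' ^ 2 * a + p ^ 2 * b := by
      have := mul_le_mul_of_nonneg_right hq (mul_pos hs hs').le
      refine this.trans_eq ?_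
      field_simp
    have ih' := mul_le_mul_of_nonneg_left ih hs'.le
    rw [edgeEnergy]
    refine le_of_mul_le_mul_left ?_ hs
    have e1 : p' ^ 2 * a = p' * (p * Real.cos t + Real.cos (m * t) * Real.sin t) * a := by
      rw [← hadd]; ring
    have e2 : p ^ 2 * b = p * (p' * Real.cos t - Real.sin t * Real.cos ((m + 1) * t)) * b := by
      rw [hadd, cadd]
      linear_combination (-p ^ 2 * b) * hpy
    linarith

theorem sum_edgeEnergy_nonneg {t : ℝ} (w : ℕ → H) (h0 : w 0 = 0) {N : ℕ} (hN : 1 ≤ N)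
    (ht : 0 < t) (hNt : N * t = Real.pi / 2) :
    0 ≤ ∑ k ∈ Finset.range N, edgeEnergy t (w k) (w (k + 1)) := by
  have h := le_sum_edgeEnergy w h0 N hN ht (by rw [hNt]; linarith [Real.pi_pos])
  rw [hNt, Real.cos_pi_div_two, Real.sin_pi_div_two] at h
  linarith

/-- A bound by the Green's function of a chain that is zero at both ends. -/
theorem norm_sq_le_of_clamped {t : ℝ} (w : ℕ → H) (h0 : w 0 = 0) {N : ℕ} (hN : w N = 0)
    (ht : 0 < t) (hNt : N * t = Real.pi / 2) {m : ℕ} (hm : m ≤ N) :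
    2 * Real.sin t * ‖w m‖ ^ 2 ≤
      Real.sin (2 * (m * t)) * ∑ k ∈ Finset.range N, edgeEnergy t (w k) (w (k + 1)) := by
  have hpi := Real.pi_pos
  rcases Nat.eq_zero_or_pos m with rfl | hm0
  · simp [h0]
  obtain ⟨d, rfl⟩ := Nat.exists_eq_add_of_le hm
  rcases Nat.eq_zero_or_pos d with rfl | hd0
  · rw [add_zero] at hN hNt ⊢
    rw [hN, hNt, mul_div_cancel₀ _ (two_ne_zero), Real.sin_pi]
    simp
  have hm1 : (1 : ℝ) ≤ m := by exact_mod_cast hm0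
  have hd1 : (1 : ℝ) ≤ d := by exact_mod_cast hd0
  push_cast at hNt
  have hdt : (d : ℝ) * t = Real.pi / 2 - m * t := by linarith
  have h1 := le_sum_edgeEnergy w h0 m hm0 ht (by nlinarith)
  have h2 := le_sum_edgeEnergy (fun k => w (m + d - k)) (by simpa using hN) d hd0 ht
    (by nlinarith)
  have hrefl : ∑ k ∈ Finset.range d, edgeEnergy t (w (m + d - k)) (w (m + d - (k + 1))) =
      ∑ k ∈ Finset.range d, edgeEnergy t (w (m + k)) (w (m + k + 1)) := by
    rw [← Finset.sum_range_reflect]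
    refine Finset.sum_congr rfl fun k hk => ?_
    have hk := Finset.mem_range.1 hk
    rw [edgeEnergy_comm]
    congr 2 <;> omega
  rw [hrefl, hdt, Real.cos_pi_div_two_sub, Real.sin_pi_div_two_sub] at h2
  simp only [add_tsub_cancel_right] at h2
  have hC : 0 ≤ Real.cos (m * t) := Real.cos_nonneg_of_neg_pi_div_two_le_of_le
    (by nlinarith) (by nlinarith)
  have hS : 0 ≤ Real.sin (m * t) := Real.sin_nonneg_of_nonneg_of_le_pi
    (by positivity) (by nlinarith)
  have h1' := mul_le_mul_of_nonneg_left h1 hC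
  have h2' := mul_le_mul_of_nonneg_left h2 hS
  rw [Finset.sum_range_add, Real.sin_two_mul]
  have hpy := Real.sin_sq_add_cos_sq (m * t)
  have e : 2 * Real.sin t * ‖w m‖ ^ 2 =
      2 * (Real.cos (m * t) * (Real.sin t * Real.cos (m * t) * ‖w m‖ ^ 2) +
        Real.sin (m * t) * (Real.sin t * Real.sin (m * t) * ‖w m‖ ^ 2)) := by
    linear_combination (-2 * Real.sin t * ‖w m‖ ^ 2) * hpy
  linarith

theorem edgeEnergy_add {t : ℝ} (w w' : H) {p p' q q' : H}
    (hp' : p' = (Real.cos t : ℂ) • p + (Real.sin t : ℂ) • q)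
    (hp : p = (Real.cos t : ℂ) • p' - (Real.sin t : ℂ) • q') :
    edgeEnergy t (w + p) (w' + p') = edgeEnergy t w w' +
      (Real.sin t * (2 * (inner ℂ w' q').re + (inner ℂ p' q').re) -
        Real.sin t * (2 * (inner ℂ w q).re + (inner ℂ p q).re)) := by
  have h1 (x : H) : (inner ℂ x p').re =
      Real.cos t * (inner ℂ x p).re + Real.sin t * (inner ℂ x q).re := by
    rw [hp', inner_add_right, inner_smul_right, inner_smul_right, Complex.add_re,
      Complex.re_ofReal_mul, Complex.re_ofReal_mul]
  have h2 (x : H) : (inner ℂ x p).re =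
      Real.cos t * (inner ℂ x p').re - Real.sin t * (inner ℂ x q').re := by
    conv_lhs => rw [hp]
    rw [inner_sub_right, inner_smul_right, inner_smul_right, Complex.sub_re,
      Complex.re_ofReal_mul, Complex.re_ofReal_mul]
  have hsymm (x y : H) : (inner ℂ x y).re = (inner ℂ y x).re := inner_re_symm (𝕜 := ℂ) x y
  have hself (x : H) : (inner ℂ x x).re = ‖x‖ ^ 2 := (norm_sq_eq_re_inner (𝕜 := ℂ) x).symm
  have n1 := norm_add_sq (𝕜 := ℂ) w p
  have n2 := norm_add_sq (𝕜 := ℂ) w' p'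
  simp only [RCLike.re_to_complex] at n1 n2
  have a1 := h1 w
  have a2 := h2 w'
  have a3 := h1 p
  have a4 := h2 p'
  rw [hself] at a3 a4
  rw [edgeEnergy, edgeEnergy, n1, n2, inner_add_left, inner_add_right, inner_add_right]
  simp only [Complex.add_re]
  rw [hsymm p w']
  have a5 := hsymm p p'
  linear_combination (-2) * a1 - 2 * a2 - a3 - a4 - a5

variable (n : ℕ) (u : ℕ → H)

/-- The vector at angle `k π / 2n` in the plane spanned by `u 0` and `u n`. -/
def planar (k : ℕ) : H :=
  (Real.cos (k * (Real.pi / (2 * n))) : ℂ) • u 0 + (Real.sin (k * (Real.pi / (2 * n))) : ℂ) • u n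

/-- The derivative of `planar` in the angle. -/
def planarDeriv (k : ℕ) : H :=
  (Real.cos (k * (Real.pi / (2 * n))) : ℂ) • u n - (Real.sin (k * (Real.pi / (2 * n))) : ℂ) • u 0

theorem planar_succ (k : ℕ) : planar n u (k + 1) =
    (Real.cos (Real.pi / (2 * n)) : ℂ) • planar n u k +
      (Real.sin (Real.pi / (2 * n)) : ℂ) • planarDeriv n u k := by
  simp only [planar, planarDeriv]
  push_cast
  rw [add_mul, one_mul, Complex.sin_add, Complex.cos_add]
  module

theorem planar_eq_succ (k : ℕ) : planar n u k =
    (Real.cos (Real.pi / (2 * n)) : ℂ) • planar n u (k + 1) -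
      (Real.sin (Real.pi / (2 * n)) : ℂ) • planarDeriv n u (k + 1) := by
  simp only [planar, planarDeriv]
  have e : ((k : ℕ) : ℝ) * (Real.pi / (2 * n)) =
    ((k + 1 : ℕ) : ℝ) * (Real.pi / (2 * n)) - Real.pi / (2 * n) := by push_cast; ring
  rw [e, Real.sin_sub, Real.cos_sub]
  push_cast
  module

variable {n} {u}

theorem angle_pos (hn : 2 ≤ n) : 0 < Real.pi / (2 * n) := by
  have : (2 : ℝ) ≤ n := by exact_mod_cast hn
  have := Real.pi_pos
  positivity

theorem mul_angle (hn : 2 ≤ n) : n * (Real.pi / (2 * n)) = Real.pi / 2 := by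
  have : (2 : ℝ) ≤ n := by exact_mod_cast hn
  field_simp

theorem two_mul_mul_angle (hn : 2 ≤ n) : (2 * n : ℕ) * (Real.pi / (2 * n)) = Real.pi := by
  have : (2 : ℝ) ≤ n := by exact_mod_cast hn
  push_cast
  field_simp

theorem planar_zero : planar n u 0 = u 0 := by simp [planar]

theorem planar_self (hn : 2 ≤ n) : planar n u n = u n := by
  rw [planar, mul_angle hn]
  simp

theorem planar_two_mul (hn : 2 ≤ n) : planar n u (2 * n) = -u 0 := by
  rw [planar, two_mul_mul_angle hn]
  simp

theorem sum_edgeEnergy_sub_planar (hn : 2 ≤ n) (hu : u (2 * n) = -u 0) {ε : ℝ}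
    (hε : ∑ k ∈ Finset.range (2 * n), edgeEnergy (Real.pi / (2 * n)) (u k) (u (k + 1)) = 2 * ε) :
    ∑ k ∈ Finset.range (2 * n), edgeEnergy (Real.pi / (2 * n)) (u k - planar n u k)
      (u (k + 1) - planar n u (k + 1)) = 2 * ε := by
  set F : ℕ → ℝ := fun k => Real.sin (Real.pi / (2 * n)) *
    (2 * (inner ℂ (u k - planar n u k) (planarDeriv n u k)).re +
      (inner ℂ (planar n u k) (planarDeriv n u k)).re) with hF
  have h (k : ℕ) := edgeEnergy_add (u k - planar n u k) (u (k + 1) - planar n u (k + 1))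
    (planar_succ n u k) (planar_eq_succ n u k)
  simp only [sub_add_cancel] at h
  have hF2 : F (2 * n) = F 0 := by
    have hd : planarDeriv n u (2 * n) = -planarDeriv n u 0 := by
      rw [planarDeriv, planarDeriv, two_mul_mul_angle hn]
      simp
    simp only [hF]
    rw [hd, planar_two_mul hn, planar_zero, hu]
    simp
  rw [← hε, Finset.sum_congr rfl fun k _ => h k, Finset.sum_add_distrib]
  have := Finset.sum_range_sub F (2 * n)
  rw [hF2, sub_self] at this
  simp only [hF] at this
  rw [this, add_zero]

end Chain

section ClosedChain

variable {H : Type*} [NormedAddCommGroup H] {n : ℕ} {u : ℕ → H} {ε : ℝ}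

theorem sin_angle_pos (hn : 2 ≤ n) : 0 < Real.sin (Real.pi / (2 * n)) := by
  have h := mul_angle hn
  have h' := angle_pos hn
  have hn' : (2 : ℝ) ≤ n := by exact_mod_cast hn
  exact Real.sin_pos_of_pos_of_lt_pi h' (by nlinarith [Real.pi_pos])

theorem angle_le (hn : 2 ≤ n) : Real.pi / (2 * n) ≤ Real.pi / 4 := by
  have h := mul_angle hn
  have h' := angle_pos hn
  have hn' : (2 : ℝ) ≤ n := by exact_mod_cast hn
  nlinarith

theorem sqrt_two_div_two_le_cos_angle (hn : 2 ≤ n) : √2 / 2 ≤ Real.cos (Real.pi / (2 * n)) := by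
  rw [← Real.cos_pi_div_four]
  exact Real.cos_le_cos_of_nonneg_of_le_pi (angle_pos hn).le (by linarith [Real.pi_pos])
    (angle_le hn)

theorem cos_angle_pos (hn : 2 ≤ n) : 0 < Real.cos (Real.pi / (2 * n)) :=
  lt_of_lt_of_le (by positivity) (sqrt_two_div_two_le_cos_angle hn)

theorem norm_le_of_clamped_neighbours (hn : 2 ≤ n) {x w w' : H} {E₁ E₂ : ℝ}
    (hE : E₁ + E₂ = 2 * ε)
    (hw : 2 * Real.sin (Real.pi / (2 * n)) * ‖w‖ ^ 2 ≤ Real.sin (2 * (Real.pi / (2 * n))) * E₁)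
    (hw' : 2 * Real.sin (Real.pi / (2 * n)) * ‖w'‖ ^ 2 ≤ Real.sin (2 * (Real.pi / (2 * n))) * E₂)
    (hx : ‖x‖ ≤ (2 * Real.cos (Real.pi / (2 * n)))⁻¹ * (‖w‖ + ‖w'‖)) :
    ‖x‖ ≤ √(eps1 ε n) := by
  have hs := sin_angle_pos hn
  have hc := cos_angle_pos hn
  rw [Real.sin_two_mul] at hw hw'
  rw [eps1]
  set c := Real.cos (Real.pi / (2 * n))
  set s := Real.sin (Real.pi / (2 * n))
  have h1 : ‖w‖ ^ 2 ≤ c * E₁ := le_of_mul_le_mul_left (by linarith) (mul_pos two_pos hs)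
  have h2 : ‖w'‖ ^ 2 ≤ c * E₂ := le_of_mul_le_mul_left (by linarith) (mul_pos two_pos hs)
  have h3 : (‖w‖ + ‖w'‖) ^ 2 ≤ 4 * (c * ε) := by
    have : c * E₁ + c * E₂ = 2 * (c * ε) := by linear_combination c * hE
    nlinarith [sq_nonneg (‖w‖ - ‖w'‖)]
  refine hx.trans (Real.le_sqrt_of_sq_le ?_)
  rw [mul_pow, inv_pow, mul_pow, inv_mul_le_iff₀ (by positivity)]
  refine h3.trans_eq ?_
  field_simp
  ring

variable [InnerProductSpace ℂ H]

/-- A closed chain whose energy is small is close to a planar one: on both halves separately, the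
distance is bounded by the energy of that half. -/
theorem exists_energies (hn : 2 ≤ n) (hu : u (2 * n) = -u 0)
    (hε : ∑ k ∈ Finset.range (2 * n), edgeEnergy (Real.pi / (2 * n)) (u k) (u (k + 1)) = 2 * ε) :
    ∃ E₁ E₂ : ℝ, 0 ≤ E₁ ∧ 0 ≤ E₂ ∧ E₁ + E₂ = 2 * ε ∧
      (∀ m ≤ n, 2 * Real.sin (Real.pi / (2 * n)) * ‖u m - planar n u m‖ ^ 2 ≤
        Real.sin (2 * (m * (Real.pi / (2 * n)))) * E₁) ∧
      (∀ m ≤ n, 2 * Real.sin (Real.pi / (2 * n)) * ‖u (n + m) - planar n u (n + m)‖ ^ 2 ≤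
        Real.sin (2 * (m * (Real.pi / (2 * n)))) * E₂) := by
  have ht := angle_pos hn
  have hnt := mul_angle hn
  have hsum := sum_edgeEnergy_sub_planar hn hu hε
  have h0 : u 0 - planar n u 0 = 0 := by rw [planar_zero, sub_self]
  have h1 : u n - planar n u n = 0 := by rw [planar_self hn, sub_self]
  have h2 : u (n + n) - planar n u (n + n) = 0 := by
    rw [← two_mul, planar_two_mul hn, hu, sub_self]
  rw [two_mul, Finset.sum_range_add] at hsum
  have hn1 : 1 ≤ n := by omega
  refine ⟨_, _, ?_, ?_, hsum, ?_, ?_⟩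
  · exact sum_edgeEnergy_nonneg (fun k => u k - planar n u k) h0 hn1 ht hnt
  · exact sum_edgeEnergy_nonneg (fun k => u (n + k) - planar n u (n + k)) h1 hn1 ht hnt
  · exact fun m hm => norm_sq_le_of_clamped (fun k => u k - planar n u k) h0 h1 ht hnt hm
  · exact fun m hm =>
      norm_sq_le_of_clamped (fun k => u (n + k) - planar n u (n + k)) h1 h2 ht hnt hm

theorem norm_sub_planar_le (hn : 2 ≤ n) (hu : u (2 * n) = -u 0)
    (hε : ∑ k ∈ Finset.range (2 * n), edgeEnergy (Real.pi / (2 * n)) (u k) (u (k + 1)) = 2 * ε)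
    {k : ℕ} (hk : k ≤ 2 * n) :
    ‖u k - planar n u k‖ ≤
      √(ε * |Real.sin (2 * (k * (Real.pi / (2 * n))))| / Real.sin (Real.pi / (2 * n))) := by
  obtain ⟨E₁, E₂, hE₁, hE₂, hE, h1, h2⟩ := exists_energies hn hu hε
  have hs := sin_angle_pos hn
  refine Real.le_sqrt_of_sq_le ?_
  rw [le_div_iff₀ hs]
  rcases le_total k n with h | h
  · have h3 := h1 k h
    have h4 := mul_le_mul_of_nonneg_right
      (le_abs_self (Real.sin (2 * (k * (Real.pi / (2 * n)))))) hE₁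
    have h5 := mul_nonneg (abs_nonneg (Real.sin (2 * (k * (Real.pi / (2 * n)))))) hE₂
    have h6 := congrArg (fun x => |Real.sin (2 * (k * (Real.pi / (2 * n))))| * x) hE
    linarith
  · obtain ⟨m, rfl⟩ := Nat.exists_eq_add_of_le h
    have h3 := h2 m (by omega)
    have e : 2 * (((n + m : ℕ) : ℝ) * (Real.pi / (2 * n))) =
        2 * (m * (Real.pi / (2 * n))) + Real.pi := by
      push_cast
      linear_combination 2 * mul_angle hn
    rw [e, Real.sin_add_pi, abs_neg]
    have h4 := mul_le_mul_of_nonneg_right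
      (le_abs_self (Real.sin (2 * (m * (Real.pi / (2 * n)))))) hE₂
    have h5 := mul_nonneg (abs_nonneg (Real.sin (2 * (m * (Real.pi / (2 * n)))))) hE₁
    have h6 := congrArg (fun x => |Real.sin (2 * (m * (Real.pi / (2 * n))))| * x) hE
    linarith

theorem norm_start_sub_neighbours_le (hn : 2 ≤ n) (hu : u (2 * n) = -u 0)
    (hε : ∑ k ∈ Finset.range (2 * n), edgeEnergy (Real.pi / (2 * n)) (u k) (u (k + 1)) = 2 * ε) :
    ‖u 0 - (((2 * Real.cos (Real.pi / (2 * n)))⁻¹ : ℝ) : ℂ) • (u 1 - u (2 * n - 1))‖ ≤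
      √(eps1 ε n) := by
  obtain ⟨E₁, E₂, -, -, hE, h1, h2⟩ := exists_energies hn hu hε
  have hc := cos_angle_pos hn
  have hw := h1 1 (by omega)
  have hw' := h2 (n - 1) (by omega)
  have e1 : ((n - 1 : ℕ) : ℝ) * (Real.pi / (2 * n)) = Real.pi / 2 - Real.pi / (2 * n) := by
    rw [Nat.cast_sub (by omega), Nat.cast_one, sub_mul, mul_angle hn, one_mul]
  have e2 : n + (n - 1) = 2 * n - 1 := by omega
  rw [e1, e2, show 2 * (Real.pi / 2 - Real.pi / (2 * n)) = Real.pi - 2 * (Real.pi / (2 * n)) by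
    ring, Real.sin_pi_sub] at hw'
  rw [Nat.cast_one, one_mul] at hw
  have key : (((2 * Real.cos (Real.pi / (2 * n)))⁻¹ : ℝ) : ℂ) •
      (planar n u 1 - planar n u (2 * n - 1)) = u 0 := by
    have e3 : ((2 * n - 1 : ℕ) : ℝ) * (Real.pi / (2 * n)) = Real.pi - Real.pi / (2 * n) := by
      rw [Nat.cast_sub (by omega), Nat.cast_one, sub_mul, two_mul_mul_angle hn, one_mul]
    rw [planar, planar, e3, Real.cos_pi_sub, Real.sin_pi_sub, Nat.cast_one, one_mul]
    have : ((Real.cos (Real.pi / (2 * n)) : ℝ) : ℂ) ≠ 0 := by exact_mod_cast hc.ne'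
    set c := Real.cos (Real.pi / (2 * n))
    set s := Real.sin (Real.pi / (2 * n))
    have e4 : ((c : ℂ) • u 0 + (s : ℂ) • u n) - (((-c : ℝ) : ℂ) • u 0 + (s : ℂ) • u n) =
        (2 * (c : ℂ)) • u 0 := by
      push_cast
      module
    rw [e4, smul_smul]
    push_cast
    rw [inv_mul_cancel₀ (by simpa using this), one_smul]
  refine norm_le_of_clamped_neighbours hn hE hw hw' ?_
  have e5 : u 0 - (((2 * Real.cos (Real.pi / (2 * n)))⁻¹ : ℝ) : ℂ) • (u 1 - u (2 * n - 1)) =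
      (((2 * Real.cos (Real.pi / (2 * n)))⁻¹ : ℝ) : ℂ) •
        ((u (2 * n - 1) - planar n u (2 * n - 1)) - (u 1 - planar n u 1)) := by
    conv_lhs => rw [← key]
    module
  rw [e5, norm_smul, Complex.norm_real, Real.norm_of_nonneg (by positivity), add_comm]
  gcongr
  exact norm_sub_le _ _

theorem norm_middle_sub_neighbours_le (hn : 2 ≤ n) (hu : u (2 * n) = -u 0)
    (hε : ∑ k ∈ Finset.range (2 * n), edgeEnergy (Real.pi / (2 * n)) (u k) (u (k + 1)) = 2 * ε) :
    ‖u n - (((2 * Real.cos (Real.pi / (2 * n)))⁻¹ : ℝ) : ℂ) • (u (n - 1) + u (n + 1))‖ ≤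
      √(eps1 ε n) := by
  obtain ⟨E₁, E₂, -, -, hE, h1, h2⟩ := exists_energies hn hu hε
  have hc := cos_angle_pos hn
  have hw := h1 (n - 1) (by omega)
  have hw' := h2 1 (by omega)
  have e1 : ((n - 1 : ℕ) : ℝ) * (Real.pi / (2 * n)) = Real.pi / 2 - Real.pi / (2 * n) := by
    rw [Nat.cast_sub (by omega), Nat.cast_one, sub_mul, mul_angle hn, one_mul]
  rw [e1, show 2 * (Real.pi / 2 - Real.pi / (2 * n)) = Real.pi - 2 * (Real.pi / (2 * n)) by
    ring, Real.sin_pi_sub] at hw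
  rw [Nat.cast_one, one_mul] at hw'
  have key : (((2 * Real.cos (Real.pi / (2 * n)))⁻¹ : ℝ) : ℂ) •
      (planar n u (n - 1) + planar n u (n + 1)) = u n := by
    have e3 : ((n + 1 : ℕ) : ℝ) * (Real.pi / (2 * n)) = Real.pi / (2 * n) + Real.pi / 2 := by
      push_cast
      linear_combination mul_angle hn
    rw [planar, planar, e1, e3, Real.cos_pi_div_two_sub, Real.sin_pi_div_two_sub,
      Real.cos_add_pi_div_two, Real.sin_add_pi_div_two]
    have : ((Real.cos (Real.pi / (2 * n)) : ℝ) : ℂ) ≠ 0 := by exact_mod_cast hc.ne'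
    set c := Real.cos (Real.pi / (2 * n))
    set s := Real.sin (Real.pi / (2 * n))
    have e4 : ((s : ℂ) • u 0 + (c : ℂ) • u n) + (((-s : ℝ) : ℂ) • u 0 + (c : ℂ) • u n) =
        (2 * (c : ℂ)) • u n := by
      push_cast
      module
    rw [e4, smul_smul]
    push_cast
    rw [inv_mul_cancel₀ (by simpa using this), one_smul]
  refine norm_le_of_clamped_neighbours hn hE hw hw' ?_
  have e5 : u n - (((2 * Real.cos (Real.pi / (2 * n)))⁻¹ : ℝ) : ℂ) • (u (n - 1) + u (n + 1)) =
      -(((2 * Real.cos (Real.pi / (2 * n)))⁻¹ : ℝ) : ℂ) •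
        ((u (n - 1) - planar n u (n - 1)) + (u (n + 1) - planar n u (n + 1))) := by
    conv_lhs => rw [← key]
    module
  rw [e5, norm_smul, norm_neg, Complex.norm_real, Real.norm_of_nonneg (by positivity)]
  gcongr
  exact norm_add_le _ _

end ClosedChain

section Ancillas

variable {H : Type*} [NormedAddCommGroup H]

theorem norm_sq_withAncillas (v : WithAncillas H) :
    ‖v‖ ^ 2 = ‖v (0, 0)‖ ^ 2 + ‖v (0, 1)‖ ^ 2 + (‖v (1, 0)‖ ^ 2 + ‖v (1, 1)‖ ^ 2) := by
  rw [PiLp.norm_sq_eq_of_L2, Fintype.sum_prod_type, Fin.sum_univ_two, Fin.sum_univ_two,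
    Fin.sum_univ_two]

theorem norm_withAncillas_le (v : WithAncillas H) :
    ‖v‖ ≤ ‖v (0, 0)‖ + ‖v (0, 1)‖ + (‖v (1, 0)‖ + ‖v (1, 1)‖) := by
  refine le_of_sq_le_sq ?_ (by positivity)
  rw [norm_sq_withAncillas]
  have h1 := norm_nonneg (v (0, 0))
  have h2 := norm_nonneg (v (0, 1))
  have h3 := norm_nonneg (v (1, 0))
  have h4 := norm_nonneg (v (1, 1))
  nlinarith [mul_nonneg h1 h2, mul_nonneg h1 h3, mul_nonneg h1 h4, mul_nonneg h2 h3,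
    mul_nonneg h2 h4, mul_nonneg h3 h4]

variable [InnerProductSpace ℂ H]

/-- The operator that one party applies when its ancilla is found in the state `a`. -/
def swapArm (X Z : H →L[ℂ] H) (a : Fin 2) : H →L[ℂ] H :=
  if a = 1 then X * (1 - Z) else 1 + Z

/-- The output of the swap circuit on `v ⊗ |00⟩`. -/
def swapVec (X Z X' Z' : H →L[ℂ] H) (v : H) : WithAncillas H :=
  WithLp.toLp 2 fun k => (4⁻¹ : ℂ) • swapArm X Z k.1 (swapArm X' Z' k.2 v)

theorem circuit_prodVec_ket00 (X Z X' Z' : H →L[ℂ] H) (v : H) :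
    circuitA X Z (circuitB X' Z' (prodVec v ket00)) = swapVec X Z X' Z' v := by
  have hs : ((√2 : ℝ) : ℂ)⁻¹ * ((√2 : ℝ) : ℂ)⁻¹ = 2⁻¹ := by
    rw [← mul_inv, ← Complex.ofReal_mul, Real.mul_self_sqrt (by norm_num)]
    norm_num
  have hs' : ((√2 : ℝ) : ℂ)⁻¹ * (((√2 : ℝ) : ℂ)⁻¹ * 2⁻¹) = 4⁻¹ := by
    rw [← mul_assoc, hs]
    norm_num
  ext k
  obtain ⟨a, b⟩ := k
  fin_cases a <;> fin_cases b <;>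
  · simp [circuitA, circuitB, swapVec, swapArm, ctrlA, ctrlB, ancGate, prodVec, ket00, hadamard,
      Fintype.sum_prod_type, Matrix.kroneckerMap_apply, Matrix.one_apply, smul_smul, hs]
    simp only [hs'] <;> module

theorem swapArm_zero (X Z : H →L[ℂ] H) (v : H) : swapArm X Z 0 v = v + Z v := by
  simp [swapArm]

theorem swapArm_one (X Z : H →L[ℂ] H) (v : H) : swapArm X Z 1 v = X v - X (Z v) := by
  simp [swapArm]

theorem swapVec_sub (X Z X' Z' : H →L[ℂ] H) (v w : H) :
    swapVec X Z X' Z' (v - w) = swapVec X Z X' Z' v - swapVec X Z X' Z' w := by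
  ext k
  simp only [swapVec, map_sub, smul_sub, PiLp.sub_apply]

theorem parallelogram_sq (x y : H) :
    ‖x + y‖ ^ 2 + ‖x - y‖ ^ 2 = 2 * ‖x‖ ^ 2 + 2 * ‖y‖ ^ 2 := by
  have h := parallelogram_law_with_norm ℂ x y
  nlinarith

end Ancillas

section Swap

variable {H : Type*} [NormedAddCommGroup H] [InnerProductSpace ℂ H] [CompleteSpace H]

/-- Binary observables `X`, `Z` of one party that commute with those, `X'`, `Z'`, of the other. -/
structure SwapObservables (X Z X' Z' : H →L[ℂ] H) : Prop where
  x : IsBinaryObservable X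
  z : IsBinaryObservable Z
  x' : IsBinaryObservable X'
  z' : IsBinaryObservable Z'
  xx : Commute X X'
  xz : Commute X Z'
  zx : Commute Z X'
  zz : Commute Z Z'

theorem norm_sq_swapArm_add {X Z : H →L[ℂ] H} (hX : IsBinaryObservable X)
    (hZ : IsBinaryObservable Z) (v : H) :
    ‖swapArm X Z 0 v‖ ^ 2 + ‖swapArm X Z 1 v‖ ^ 2 = 4 * ‖v‖ ^ 2 := by
  rw [swapArm_zero, swapArm_one, ← map_sub, hX.norm_apply, parallelogram_sq, hZ.norm_apply]
  ring

theorem norm_swapArm_le {X Z : H →L[ℂ] H} (hX : IsBinaryObservable X)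
    (hZ : IsBinaryObservable Z) (a : Fin 2) (v : H) : ‖swapArm X Z a v‖ ≤ 2 * ‖v‖ := by
  have h := norm_sq_swapArm_add hX hZ v
  refine le_of_sq_le_sq ?_ (by positivity)
  rcases Fin.exists_fin_two.1 ⟨a, rfl⟩ with rfl | rfl
  · nlinarith [sq_nonneg ‖swapArm X Z 1 v‖]
  · nlinarith [sq_nonneg ‖swapArm X Z 0 v‖]

theorem norm_swapVec {X Z X' Z' : H →L[ℂ] H} (h : SwapObservables X Z X' Z') (v : H) :
    ‖swapVec X Z X' Z' v‖ = ‖v‖ := by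
  refine (sq_eq_sq₀ (norm_nonneg _) (norm_nonneg _)).1 ?_
  have h0 := norm_sq_swapArm_add h.x h.z (swapArm X' Z' 0 v)
  have h1 := norm_sq_swapArm_add h.x h.z (swapArm X' Z' 1 v)
  have h2 := norm_sq_swapArm_add h.x' h.z' v
  rw [norm_sq_withAncillas]
  simp only [swapVec, norm_smul, mul_pow]
  norm_num
  linarith

end Swap

section Rotation

variable {H : Type*} [NormedAddCommGroup H] [InnerProductSpace ℂ H]

theorem ancGate_pauliXZ_zero (t : ℝ) (v : WithAncillas H) (b : Fin 2) :
    ancGate (pauliXZ t ⊗ₖ 1) v (0, b) =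
      (Real.cos t : ℂ) • v (0, b) + (Real.sin t : ℂ) • v (1, b) := by
  fin_cases b <;>
    simp [ancGate, pauliXZ, Fintype.sum_prod_type, Matrix.kroneckerMap_apply, Matrix.one_apply]

theorem ancGate_pauliXZ_one (t : ℝ) (v : WithAncillas H) (b : Fin 2) :
    ancGate (pauliXZ t ⊗ₖ 1) v (1, b) =
      (Real.sin t : ℂ) • v (0, b) - (Real.cos t : ℂ) • v (1, b) := by
  fin_cases b <;>
    simp [ancGate, pauliXZ, Fintype.sum_prod_type, Matrix.kroneckerMap_apply, Matrix.one_apply,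
      sub_eq_add_neg]

theorem ancGate_sub (M : Matrix (Fin 2 × Fin 2) (Fin 2 × Fin 2) ℂ) (v w : WithAncillas H) :
    ancGate M (v - w) = ancGate M v - ancGate M w := by
  ext k
  simp only [ancGate, PiLp.sub_apply, smul_sub, Finset.sum_sub_distrib]

theorem ancGate_prodVec (M : Matrix (Fin 2 × Fin 2) (Fin 2 × Fin 2) ℂ) (φ : H)
    (x : Fin 2 × Fin 2 → ℂ) : ancGate M (prodVec φ x) = prodVec φ (M.mulVec x) := by
  ext k
  simp only [ancGate, prodVec, Matrix.mulVec, dotProduct, smul_smul, Finset.sum_smul]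

theorem norm_sq_rotation (t : ℝ) (x y : H) :
    ‖(Real.cos t : ℂ) • x + (Real.sin t : ℂ) • y‖ ^ 2 +
      ‖(Real.sin t : ℂ) • x - (Real.cos t : ℂ) • y‖ ^ 2 = ‖x‖ ^ 2 + ‖y‖ ^ 2 := by
  have h1 := norm_add_sq (𝕜 := ℂ) ((Real.cos t : ℂ) • x) ((Real.sin t : ℂ) • y)
  have h2 := norm_sub_sq (𝕜 := ℂ) ((Real.sin t : ℂ) • x) ((Real.cos t : ℂ) • y)
  rw [inner_smul_left, inner_smul_right, norm_smul, norm_smul, Complex.conj_ofReal,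
    RCLike.re_to_complex, Complex.re_ofReal_mul, Complex.re_ofReal_mul, Complex.norm_real,
    Complex.norm_real, mul_pow, mul_pow, Real.norm_eq_abs, Real.norm_eq_abs, sq_abs, sq_abs]
    at h1 h2
  rw [h1, h2]
  linear_combination (‖x‖ ^ 2 + ‖y‖ ^ 2) * Real.sin_sq_add_cos_sq t

theorem norm_ancGate_pauliXZ (t : ℝ) (v : WithAncillas H) :
    ‖ancGate (pauliXZ t ⊗ₖ 1) v‖ = ‖v‖ := by
  refine (sq_eq_sq₀ (norm_nonneg _) (norm_nonneg _)).1 ?_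
  rw [norm_sq_withAncillas, norm_sq_withAncillas, ancGate_pauliXZ_zero, ancGate_pauliXZ_zero,
    ancGate_pauliXZ_one, ancGate_pauliXZ_one]
  linarith [norm_sq_rotation t (v (0, 0)) (v (1, 0)), norm_sq_rotation t (v (0, 1)) (v (1, 1))]

theorem prodVec_sub (φ φ' : H) (x : Fin 2 × Fin 2 → ℂ) :
    prodVec (φ - φ') x = prodVec φ x - prodVec φ' x := by
  ext k
  simp only [prodVec, smul_sub, PiLp.sub_apply]

theorem norm_prodVec_phiPlus (φ : H) : ‖prodVec φ phiPlus‖ = ‖φ‖ := by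
  refine (sq_eq_sq₀ (norm_nonneg _) (norm_nonneg _)).1 ?_
  rw [norm_sq_withAncillas]
  have h : ‖((1 / √2 : ℝ) : ℂ)‖ ^ 2 = 1 / 2 := by
    rw [Complex.norm_real, Real.norm_eq_abs, sq_abs, div_pow, Real.sq_sqrt (by norm_num), one_pow]
  simp only [prodVec, phiPlus, norm_smul, mul_pow, if_true, h]
  norm_num
  ring

theorem pauliXZ_mulVec_phiPlus (t : ℝ) :
    ((1 : Matrix (Fin 2) (Fin 2) ℂ) ⊗ₖ pauliXZ t).mulVec phiPlus =
      (pauliXZ t ⊗ₖ (1 : Matrix (Fin 2) (Fin 2) ℂ)).mulVec phiPlus := by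
  ext k
  obtain ⟨a, b⟩ := k
  fin_cases a <;> fin_cases b <;>
    simp [pauliXZ, phiPlus, Matrix.mulVec, dotProduct, Fintype.sum_prod_type,
      Matrix.kroneckerMap_apply, Matrix.one_apply]

theorem pauliXZ_kronecker_mulVec_phiPlus (s t : ℝ) :
    (pauliXZ s ⊗ₖ pauliXZ t).mulVec phiPlus =
      (pauliXZ s ⊗ₖ (1 : Matrix (Fin 2) (Fin 2) ℂ)).mulVec
        ((pauliXZ t ⊗ₖ (1 : Matrix (Fin 2) (Fin 2) ℂ)).mulVec phiPlus) := by
  rw [← pauliXZ_mulVec_phiPlus t, Matrix.mulVec_mulVec, ← Matrix.mul_kronecker_mul, mul_one,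
    one_mul]

end Rotation

section Estimates

variable {H : Type*} [NormedAddCommGroup H] [InnerProductSpace ℂ H]
  {X Z X' Z' : H →L[ℂ] H}

theorem apply_comm {S T : H →L[ℂ] H} (h : Commute S T) (v : H) : T (S v) = S (T v) :=
  (congrArg (fun R : H →L[ℂ] H => R v) h.eq).symm

/-- `cos t • Z + sin t • X`. -/
def obs (X Z : H →L[ℂ] H) (t : ℝ) : H →L[ℂ] H :=
  (Real.cos t : ℂ) • Z + (Real.sin t : ℂ) • X

theorem obs_apply (X Z : H →L[ℂ] H) (t : ℝ) (v : H) :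
    obs X Z t v = (Real.cos t : ℂ) • Z v + (Real.sin t : ℂ) • X v := rfl

theorem abs_cos_add_abs_sin_le (t : ℝ) : |Real.cos t| + |Real.sin t| ≤ √2 := by
  refine Real.le_sqrt_of_sq_le ?_
  nlinarith [Real.sin_sq_add_cos_sq t, sq_abs (Real.cos t), sq_abs (Real.sin t),
    sq_nonneg (|Real.cos t| - |Real.sin t|)]

theorem norm_smul_add_smul_le {x y : H} {r : ℝ} (hx : ‖x‖ ≤ r) (hy : ‖y‖ ≤ r) (t : ℝ) :
    ‖(Real.cos t : ℂ) • x + (Real.sin t : ℂ) • y‖ ≤ √2 * r := by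
  refine (norm_add_le _ _).trans ?_
  rw [norm_smul, norm_smul, Complex.norm_real, Complex.norm_real, Real.norm_eq_abs,
    Real.norm_eq_abs]
  calc |Real.cos t| * ‖x‖ + |Real.sin t| * ‖y‖ ≤ |Real.cos t| * r + |Real.sin t| * r := by gcongr
    _ = (|Real.cos t| + |Real.sin t|) * r := by ring
    _ ≤ √2 * r := by
        gcongr
        · exact (norm_nonneg x).trans hx
        · exact abs_cos_add_abs_sin_le t

variable [CompleteSpace H]

theorem norm_obs_apply_le (hX : IsBinaryObservable X) (hZ : IsBinaryObservable Z) (t : ℝ) (v : H) :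
    ‖obs X Z t v‖ ≤ √2 * ‖v‖ :=
  norm_smul_add_smul_le (hZ.norm_apply v).le (hX.norm_apply v).le t

/-- If `cos t • Z + sin t • X` acts on `ψ` almost like a binary observable that commutes with `X`
and `Z`, then `X` and `Z` almost anticommute on `ψ`. -/
theorem anticommutator_le {B : H →L[ℂ] H} (hX : IsBinaryObservable X)
    (hZ : IsBinaryObservable Z) (hB : IsBinaryObservable B) (hXB : Commute X B)
    (hZB : Commute Z B) {t η : ℝ} {ψ : H} (h : ‖B ψ - obs X Z t ψ‖ ≤ η) :
    |Real.sin (2 * t)| * ‖X (Z ψ) + Z (X ψ)‖ ≤ 2 * ((1 + √2) * η) := by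
  have hcomm : obs X Z t (B ψ) = B (obs X Z t ψ) := by
    simp only [obs_apply, map_add, map_smul, apply_comm hXB, apply_comm hZB]
  have hsq : obs X Z t (obs X Z t ψ) = ψ +
      ((Real.cos t * Real.sin t : ℝ) : ℂ) • (X (Z ψ) + Z (X ψ)) := by
    have hpy : (Real.cos t : ℂ) * Real.cos t + (Real.sin t : ℂ) * Real.sin t = 1 := by
      have := Real.sin_sq_add_cos_sq t
      exact_mod_cast (by linarith : Real.cos t * Real.cos t + Real.sin t * Real.sin t = 1)
    calc obs X Z t (obs X Z t ψ)
        = ((Real.cos t : ℂ) * Real.cos t + (Real.sin t : ℂ) * Real.sin t) • ψ +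
          ((Real.cos t * Real.sin t : ℝ) : ℂ) • (X (Z ψ) + Z (X ψ)) := by
          simp only [obs_apply, map_add, map_smul, hX.apply_apply, hZ.apply_apply]
          push_cast
          module
      _ = _ := by rw [hpy, one_smul]
  have key : ((Real.cos t * Real.sin t : ℝ) : ℂ) • (X (Z ψ) + Z (X ψ)) =
      -(obs X Z t (B ψ - obs X Z t ψ) + B (B ψ - obs X Z t ψ)) := by
    rw [map_sub, map_sub, hsq, hcomm, hB.apply_apply]
    module
  have hn := congrArg norm key
  rw [norm_smul, norm_neg, Complex.norm_real, Real.norm_eq_abs] at hn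
  have h1 := norm_add_le (obs X Z t (B ψ - obs X Z t ψ)) (B (B ψ - obs X Z t ψ))
  have h2 := norm_obs_apply_le hX hZ t (B ψ - obs X Z t ψ)
  rw [hB.norm_apply] at h1
  have h3 : √2 * ‖B ψ - obs X Z t ψ‖ ≤ √2 * η := by gcongr
  have h4 : |Real.sin (2 * t)| = 2 * |Real.cos t * Real.sin t| := by
    rw [Real.sin_two_mul, mul_assoc, abs_mul, abs_two, mul_comm (Real.sin t)]
  rw [h4, mul_assoc, hn]
  linarith

theorem swapArm_z (hZ : IsBinaryObservable Z) (v : H) :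
    swapArm X Z 0 (Z v) = swapArm X Z 0 v ∧ swapArm X Z 1 (Z v) = -swapArm X Z 1 v := by
  simp only [swapArm_zero, swapArm_one, hZ.apply_apply]
  exact ⟨add_comm _ _, (neg_sub _ _).symm⟩

theorem swapArm_x (hX : IsBinaryObservable X) (v : H) :
    swapArm X Z 0 (X v) - swapArm X Z 1 v = X (Z v) + Z (X v) ∧
      swapArm X Z 1 (X v) - swapArm X Z 0 v = -X (X (Z v) + Z (X v)) := by
  simp only [swapArm_zero, swapArm_one, map_add, hX.apply_apply]
  constructor <;> abel

theorem swapArm_comm (h : SwapObservables X Z X' Z') (a b : Fin 2) (v : H) :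
    swapArm X Z a (swapArm X' Z' b v) = swapArm X' Z' b (swapArm X Z a v) := by
  rcases Fin.exists_fin_two.1 ⟨a, rfl⟩ with rfl | rfl <;>
  rcases Fin.exists_fin_two.1 ⟨b, rfl⟩ with rfl | rfl <;>
  · simp only [swapArm_zero, swapArm_one, map_add, map_sub, apply_comm h.xx, apply_comm h.xz,
      apply_comm h.zx, apply_comm h.zz]
    abel

/-- The circuit turns `cos t • Z + sin t • X` into the corresponding Pauli observable of the
ancilla, up to the anticommutator of `X` and `Z`. -/
theorem norm_swapVec_obs_sub_le (h : SwapObservables X Z X' Z') (t : ℝ) (v : H) :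
    ‖swapVec X Z X' Z' (obs X Z t v) -
        ancGate (pauliXZ t ⊗ₖ 1) (swapVec X Z X' Z' v)‖ ≤ 2 * ‖X (Z v) + Z (X v)‖ := by
  set D := X (Z v) + Z (X v) with hD
  have hsin : ‖(Real.sin t : ℂ)‖ ≤ 1 := by
    rw [Complex.norm_real, Real.norm_eq_abs]
    exact Real.abs_sin_le_one t
  have hz := swapArm_z (X := X) h.z v
  have hx := swapArm_x (Z := Z) h.x v
  have bound (b : Fin 2) (x : H) (hx : ‖x‖ = ‖D‖) :
      ‖(4⁻¹ : ℂ) • (Real.sin t : ℂ) • swapArm X' Z' b x‖ ≤ 2⁻¹ * ‖D‖ := by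
    rw [norm_smul, norm_smul, ← hx]
    have h1 := norm_swapArm_le h.x' h.z' b x
    have h2 := mul_le_mul hsin h1 (norm_nonneg _) zero_le_one
    norm_num at h2 ⊢
    linarith
  have e0 (b : Fin 2) : (swapVec X Z X' Z' (obs X Z t v) -
      ancGate (pauliXZ t ⊗ₖ 1) (swapVec X Z X' Z' v)) (0, b) =
        (4⁻¹ : ℂ) • (Real.sin t : ℂ) • swapArm X' Z' b D := by
    rw [PiLp.sub_apply, ancGate_pauliXZ_zero]
    simp only [swapVec]
    rw [swapArm_comm h, swapArm_comm h, swapArm_comm h, hD, ← hx.1, obs_apply, map_add, map_smul,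
      map_smul, hz.1]
    simp only [map_add, map_sub, map_smul]
    module
  have e1 (b : Fin 2) : (swapVec X Z X' Z' (obs X Z t v) -
      ancGate (pauliXZ t ⊗ₖ 1) (swapVec X Z X' Z' v)) (1, b) =
        (4⁻¹ : ℂ) • (Real.sin t : ℂ) • swapArm X' Z' b (-X D) := by
    rw [PiLp.sub_apply, ancGate_pauliXZ_one]
    simp only [swapVec]
    rw [swapArm_comm h, swapArm_comm h, swapArm_comm h, ← hx.2, obs_apply, map_add, map_smul,
      map_smul, hz.2]
    simp only [map_add, map_sub, map_neg, map_smul]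
    module
  refine (norm_withAncillas_le _).trans ?_
  rw [e0, e0, e1, e1]
  have hXD : ‖-X D‖ = ‖D‖ := by rw [norm_neg, h.x.norm_apply]
  linarith [bound 0 D rfl, bound 1 D rfl, bound 0 (-X D) hXD, bound 1 (-X D) hXD]

variable {ψ : H} {μ ω : ℝ}

/-- The output of the circuit is almost the product of a junk vector with `|φ₊⟩`. -/
theorem norm_swapVec_sub_prodVec_le (h : SwapObservables X Z X' Z')
    (hx : ‖X ψ - X' ψ‖ ≤ μ) (hz : ‖Z ψ - Z' ψ‖ ≤ μ) (hω : ‖X (Z ψ) + Z (X ψ)‖ ≤ ω) :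
    ‖swapVec X Z X' Z' ψ -
        prodVec (((2 * √2)⁻¹ : ℝ) • ((1 + Z) ((1 + Z') ψ))) phiPlus‖ ≤ 3 * μ + ω / 2 := by
  have hφ : ((1 / √2 : ℝ) : ℂ) • (((2 * √2)⁻¹ : ℝ) • ((1 + Z) ((1 + Z') ψ))) =
      (4⁻¹ : ℂ) • ((1 + Z) ((1 + Z') ψ)) := by
    rw [← Complex.coe_smul, smul_smul, ← Complex.ofReal_mul]
    congr 1
    have : 1 / √2 * (2 * √2)⁻¹ = 4⁻¹ := by
      field_simp
      rw [Real.sq_sqrt (by norm_num)]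
      norm_num
    rw [this]
    norm_num
  have hplus (v : H) : ‖v + Z v‖ ≤ 2 * ‖v‖ := by
    rw [← swapArm_zero X]
    exact norm_swapArm_le h.x h.z 0 v
  have hminus (v : H) : ‖X v - X (Z v)‖ ≤ 2 * ‖v‖ := by
    rw [← swapArm_one]
    exact norm_swapArm_le h.x h.z 1 v
  have n4 : ‖(4⁻¹ : ℂ)‖ = 4⁻¹ := by norm_num
  refine (norm_withAncillas_le _).trans ?_
  have c00 : (swapVec X Z X' Z' ψ -
      prodVec (((2 * √2)⁻¹ : ℝ) • ((1 + Z) ((1 + Z') ψ))) phiPlus) (0, 0) = 0 := by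
    rw [PiLp.sub_apply]
    simp only [swapVec, prodVec, phiPlus, if_true]
    rw [hφ, swapArm_zero, swapArm_zero]
    exact sub_self _
  have c01 : (swapVec X Z X' Z' ψ -
      prodVec (((2 * √2)⁻¹ : ℝ) • ((1 + Z) ((1 + Z') ψ))) phiPlus) (0, 1) =
        (4⁻¹ : ℂ) • X' ((Z ψ - Z' ψ) + Z (Z ψ - Z' ψ)) := by
    rw [PiLp.sub_apply]
    simp only [swapVec, prodVec, phiPlus, zero_ne_one, if_false, zero_smul, sub_zero]
    rw [swapArm_zero, swapArm_one]
    simp only [map_add, map_sub, apply_comm h.zx, h.z.apply_apply]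
    module
  have c10 : (swapVec X Z X' Z' ψ -
      prodVec (((2 * √2)⁻¹ : ℝ) • ((1 + Z) ((1 + Z') ψ))) phiPlus) (1, 0) =
        -(4⁻¹ : ℂ) • (X (Z ψ - Z' ψ) - X (Z (Z ψ - Z' ψ))) := by
    rw [PiLp.sub_apply]
    simp only [swapVec, prodVec, phiPlus, one_ne_zero, if_false, zero_smul, sub_zero]
    rw [swapArm_zero, swapArm_one]
    simp only [map_add, map_sub, h.z.apply_apply]
    module
  have c11 : (swapVec X Z X' Z' ψ -
      prodVec (((2 * √2)⁻¹ : ℝ) • ((1 + Z) ((1 + Z') ψ))) phiPlus) (1, 1) =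
        (4⁻¹ : ℂ) • (X' (X (Z ψ - Z' ψ) - X (Z (Z ψ - Z' ψ))) -
          (2 : ℝ) • (X (X ψ - X' ψ) - X (Z (X ψ - X' ψ))) -
          (2 : ℝ) • X (X (Z ψ) + Z (X ψ)) + ((Z ψ - Z' ψ) + Z (Z ψ - Z' ψ))) := by
    rw [PiLp.sub_apply]
    simp only [swapVec, prodVec, phiPlus, if_true]
    rw [hφ, swapArm_one, swapArm_one]
    simp only [add_apply, one_apply_eq_self, map_add, map_sub, apply_comm h.xx,
      apply_comm h.zx, h.z.apply_apply, h.x.apply_apply]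
    module
  have b1 : ‖(Z ψ - Z' ψ) + Z (Z ψ - Z' ψ)‖ ≤ 2 * μ :=
    (hplus _).trans (by gcongr)
  have b2 : ‖X (Z ψ - Z' ψ) - X (Z (Z ψ - Z' ψ))‖ ≤ 2 * μ :=
    (hminus _).trans (by gcongr)
  have b3 : ‖X (X ψ - X' ψ) - X (Z (X ψ - X' ψ))‖ ≤ 2 * μ :=
    (hminus _).trans (by gcongr)
  rw [c00, c01, c10, c11, norm_zero, norm_smul, norm_smul, norm_smul, norm_neg, n4,
    h.x'.norm_apply]
  have b4 : ‖X' (X (Z ψ - Z' ψ) - X (Z (Z ψ - Z' ψ))) -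
      (2 : ℝ) • (X (X ψ - X' ψ) - X (Z (X ψ - X' ψ))) -
      (2 : ℝ) • X (X (Z ψ) + Z (X ψ)) + ((Z ψ - Z' ψ) + Z (Z ψ - Z' ψ))‖ ≤ 8 * μ + 2 * ω := by
    refine (norm_add_le _ _).trans ?_
    have s1 := norm_sub_le (X' (X (Z ψ - Z' ψ) - X (Z (Z ψ - Z' ψ))) -
      (2 : ℝ) • (X (X ψ - X' ψ) - X (Z (X ψ - X' ψ)))) ((2 : ℝ) • X (X (Z ψ) + Z (X ψ)))
    have s2 := norm_sub_le (X' (X (Z ψ - Z' ψ) - X (Z (Z ψ - Z' ψ))))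
      ((2 : ℝ) • (X (X ψ - X' ψ) - X (Z (X ψ - X' ψ))))
    rw [norm_smul, Real.norm_two] at s1 s2
    rw [h.x.norm_apply] at s1
    rw [h.x'.norm_apply] at s2
    linarith
  linarith

/-- The junk vector has length almost `2 √2`. -/
theorem norm_smul_junk_sub_le (h : SwapObservables X Z X' Z') (hψ : ‖ψ‖ = 1)
    (hx : ‖X ψ - X' ψ‖ ≤ μ) (hz : ‖Z ψ - Z' ψ‖ ≤ μ) (hω : ‖X (Z ψ) + Z (X ψ)‖ ≤ ω) {φ : H}
    (hφ : φ = (1 + Z) ((1 + Z') ψ)) :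
    ‖((2 * √2)⁻¹ : ℝ) • φ - ((‖φ‖⁻¹ : ℝ) : ℂ) • φ‖ ≤ 2 * μ + ω / 2 := by
  have hre (x y : H) : |(inner ℂ x y).re| ≤ ‖x‖ * ‖y‖ :=
    (Complex.abs_re_le_norm _).trans (norm_inner_le_norm x y)
  have hself (x : H) : (inner ℂ x x).re = ‖x‖ ^ 2 := (norm_sq_eq_re_inner (𝕜 := ℂ) x).symm
  have hN : ‖φ‖ ^ 2 = 4 + 4 * (inner ℂ ψ (Z ψ)).re + 4 * (inner ℂ ψ (Z' ψ)).re +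
      4 * (inner ℂ (Z ψ) (Z' ψ)).re := by
    have e1 := norm_add_sq (𝕜 := ℂ) (ψ + Z' ψ) (Z (ψ + Z' ψ))
    have e2 := norm_add_sq (𝕜 := ℂ) ψ (Z' ψ)
    rw [h.z.norm_apply] at e1
    rw [h.z'.norm_apply, hψ] at e2
    have e3 : φ = ψ + Z' ψ + Z (ψ + Z' ψ) := by rw [hφ]; rfl
    have e4 : (inner ℂ (Z' ψ) (Z (Z' ψ)) : ℂ) = inner ℂ ψ (Z ψ) := by
      rw [inner_apply_of_isSelfAdjoint h.z'.1, apply_comm h.zz, h.z'.apply_apply]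
    have e5 : (inner ℂ ψ (Z (Z' ψ)) : ℂ) = inner ℂ (Z ψ) (Z' ψ) := by
      rw [inner_apply_of_isSelfAdjoint h.z.1]
    have e6 : (inner ℂ (Z' ψ) (Z ψ)).re = (inner ℂ (Z ψ) (Z' ψ)).re :=
      inner_re_symm (𝕜 := ℂ) _ _
    rw [map_add, inner_add_left, inner_add_right, inner_add_right, e4, e5] at e1
    rw [← map_add, ← e3] at e1
    simp only [RCLike.re_to_complex, Complex.add_re] at e1 e2
    rw [e6] at e1
    rw [e1, e2]
    ring
  set a := (inner ℂ ψ (Z ψ)).re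
  set b := (inner ℂ ψ (Z' ψ)).re
  set d := (inner ℂ (Z ψ) (Z' ψ)).re
  have hab : |a - b| ≤ μ := by
    have := hre ψ (Z ψ - Z' ψ)
    rw [inner_sub_right, Complex.sub_re, hψ, one_mul] at this
    exact this.trans hz
  have hd : |1 - d| ≤ μ := by
    have := hre (Z ψ) (Z ψ - Z' ψ)
    rw [inner_sub_right, Complex.sub_re, hself, h.z.norm_apply, hψ, one_mul, one_pow] at this
    exact this.trans hz
  have ha : |2 * a| ≤ ω + 2 * μ := by
    have e1 : 2 * a = (inner ℂ (X ψ) (X (Z ψ) + Z (X ψ))).re -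
        ((inner ℂ (X ψ - X' ψ) (Z (X ψ))).re + (inner ℂ (X' ψ) (Z (X ψ - X' ψ))).re) := by
      have e2 : (inner ℂ (X ψ) (X (Z ψ)) : ℂ) = inner ℂ ψ (Z ψ) := by
        rw [inner_apply_of_isSelfAdjoint h.x.1, h.x.apply_apply]
      have e3 : (inner ℂ (X' ψ) (Z (X' ψ)) : ℂ) = inner ℂ ψ (Z ψ) := by
        rw [inner_apply_of_isSelfAdjoint h.x'.1, apply_comm h.zx, h.x'.apply_apply]
      rw [map_sub, inner_add_right, inner_sub_left, inner_sub_right, e2, e3]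
      simp only [Complex.add_re, Complex.sub_re]
      ring
    have b1 := hre (X ψ) (X (Z ψ) + Z (X ψ))
    have b2 := hre (X ψ - X' ψ) (Z (X ψ))
    have b3 := hre (X' ψ) (Z (X ψ - X' ψ))
    rw [h.x.norm_apply, hψ, one_mul] at b1
    rw [h.z.norm_apply, h.x.norm_apply, hψ, mul_one] at b2
    rw [h.z.norm_apply, h.x'.norm_apply, hψ, one_mul] at b3
    rw [e1]
    rw [abs_le] at b1 b2 b3 ⊢
    constructor <;> linarith
  have hN8 : |‖φ‖ ^ 2 - 8| ≤ 8 * (2 * μ + ω / 2) := by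
    rw [hN]
    rw [abs_le] at hab hd ha ⊢
    constructor <;> linarith
  rcases eq_or_ne φ 0 with h0 | h0
  · rw [h0, smul_zero, smul_zero, sub_zero, norm_zero]
    have := (abs_nonneg _).trans hN8
    linarith
  have hpos : 0 < ‖φ‖ := norm_pos_iff.2 h0
  rw [Complex.coe_smul, ← sub_smul, norm_smul, Real.norm_eq_abs]
  have h2 : 0 < √2 := by positivity
  have h2' : √2 ^ 2 = 2 := Real.sq_sqrt (by norm_num)
  have e : ((2 * √2)⁻¹ - ‖φ‖⁻¹) * ‖φ‖ = (2 * √2)⁻¹ * (‖φ‖ - 2 * √2) := by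
    field_simp
  rw [← abs_of_pos hpos, ← abs_mul, abs_of_pos hpos, e, abs_mul, abs_of_pos (by positivity),
    inv_mul_le_iff₀ (by positivity)]
  have e2 : |‖φ‖ ^ 2 - 8| = |‖φ‖ - 2 * √2| * (‖φ‖ + 2 * √2) := by
    have e4 : ‖φ‖ ^ 2 - 8 = (‖φ‖ - 2 * √2) * (‖φ‖ + 2 * √2) := by linear_combination 4 * h2'
    rw [e4, abs_mul, abs_of_pos (by positivity : 0 < ‖φ‖ + 2 * √2)]
  have e3 : |‖φ‖ - 2 * √2| * (2 * √2) ≤ 8 * (2 * μ + ω / 2) := by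
    refine le_trans ?_ (e2 ▸ hN8)
    gcongr
    linarith
  refine le_of_mul_le_mul_right (e3.trans_eq ?_) (by positivity : 0 < 2 * √2)
  linear_combination (-4 * (2 * μ + ω / 2)) * h2'

/-- The output of the circuit is almost the product of the normalised junk vector with `|φ₊⟩`. -/
theorem norm_swapVec_sub_junk_le (h : SwapObservables X Z X' Z') (hψ : ‖ψ‖ = 1)
    (hx : ‖X ψ - X' ψ‖ ≤ μ) (hz : ‖Z ψ - Z' ψ‖ ≤ μ) (hω : ‖X (Z ψ) + Z (X ψ)‖ ≤ ω) {φ : H}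
    (hφ : φ = (1 + Z) ((1 + Z') ψ)) :
    ‖swapVec X Z X' Z' ψ - prodVec (((‖φ‖⁻¹ : ℝ) : ℂ) • φ) phiPlus‖ ≤ 5 * μ + ω := by
  have h1 := norm_swapVec_sub_prodVec_le h hx hz hω
  have h2 := norm_smul_junk_sub_le h hψ hx hz hω hφ
  rw [← hφ] at h1
  rw [← norm_prodVec_phiPlus, prodVec_sub] at h2
  refine (norm_sub_le_norm_sub_add_norm_sub _ (prodVec (((2 * √2)⁻¹ : ℝ) • φ) phiPlus) _).trans ?_
  linarith

/-- The output of the circuit for a vector close to `(cos t • Z + sin t • X) v`. -/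
theorem norm_swapVec_sub_ancGate_le (h : SwapObservables X Z X' Z') {v w : H} {t η τ : ℝ}
    {y : WithAncillas H} (hv : ‖v - obs X Z t w‖ ≤ η) (hω : ‖X (Z w) + Z (X w)‖ ≤ ω)
    (hw : ‖swapVec X Z X' Z' w - y‖ ≤ τ) :
    ‖swapVec X Z X' Z' v - ancGate (pauliXZ t ⊗ₖ 1) y‖ ≤ η + 2 * ω + τ := by
  have h1 : ‖swapVec X Z X' Z' v - swapVec X Z X' Z' (obs X Z t w)‖ ≤ η := by
    rwa [← swapVec_sub, norm_swapVec h]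
  have h2 := norm_swapVec_obs_sub_le h t w
  have h3 : ‖ancGate (pauliXZ t ⊗ₖ 1) (swapVec X Z X' Z' w) - ancGate (pauliXZ t ⊗ₖ 1) y‖ ≤ τ := by
    rwa [← ancGate_sub, norm_ancGate_pauliXZ]
  have h4 := norm_sub_le_norm_sub_add_norm_sub (swapVec X Z X' Z' v)
    (swapVec X Z X' Z' (obs X Z t w)) (ancGate (pauliXZ t ⊗ₖ 1) y)
  have h5 := norm_sub_le_norm_sub_add_norm_sub (swapVec X Z X' Z' (obs X Z t w))
    (ancGate (pauliXZ t ⊗ₖ 1) (swapVec X Z X' Z' w)) (ancGate (pauliXZ t ⊗ₖ 1) y)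
  linarith

theorem norm_anticommutator_obs_le (hX : IsBinaryObservable X) (hZ : IsBinaryObservable Z)
    (hω : ‖X (Z ψ) + Z (X ψ)‖ ≤ ω) (t : ℝ) :
    ‖X (Z (obs X Z t ψ)) + Z (X (obs X Z t ψ))‖ ≤ √2 * ω := by
  have e : X (Z (obs X Z t ψ)) + Z (X (obs X Z t ψ)) = obs X Z t (X (Z ψ) + Z (X ψ)) := by
    simp only [obs_apply, map_add, map_smul, hX.apply_apply, hZ.apply_apply]
    module
  rw [e]
  exact (norm_obs_apply_le hX hZ t _).trans (by gcongr)

theorem norm_mul_sub_obs_obs_le {A B : H →L[ℂ] H} (hX : IsBinaryObservable X)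
    (hZ : IsBinaryObservable Z) (hB : IsBinaryObservable B) (hXB : Commute X B)
    (hZB : Commute Z B) (hAB : Commute A B) {s t η : ℝ} (hA' : ‖A ψ - obs X Z s ψ‖ ≤ η)
    (hB' : ‖B ψ - obs X Z t ψ‖ ≤ η) :
    ‖A (B ψ) - obs X Z s (obs X Z t ψ)‖ ≤ (1 + √2) * η := by
  have hcomm : obs X Z s (B ψ) = B (obs X Z s ψ) := by
    simp only [obs_apply, map_add, map_smul, apply_comm hXB, apply_comm hZB]
  have e : A (B ψ) - obs X Z s (obs X Z t ψ) =
      B (A ψ - obs X Z s ψ) + obs X Z s (B ψ - obs X Z t ψ) := by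
    rw [map_sub, map_sub, hcomm, apply_comm hAB]
    abel
  rw [e]
  refine (norm_add_le _ _).trans ?_
  have h1 := norm_obs_apply_le hX hZ s (B ψ - obs X Z t ψ)
  have h2 : √2 * ‖B ψ - obs X Z t ψ‖ ≤ √2 * η := by gcongr
  rw [hB.norm_apply]
  linarith

end Estimates

section Experiment

variable {HA HB : Type*} [NormedAddCommGroup HA] [InnerProductSpace ℂ HA]
  [NormedAddCommGroup HB] [InnerProductSpace ℂ HB]

/-- The vectors `A 1 ψ, B 1 ψ, A 2 ψ, B 2 ψ, …, B n ψ, -A 1 ψ`. -/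
def chainVec (n : ℕ) (A : ℕ → HA →L[ℂ] HA) (B : ℕ → HB →L[ℂ] HB) (ψ : Joint HA HB) (k : ℕ) :
    Joint HA HB :=
  if Even k then onA (wrap n A (k / 2 + 1)) ψ else onB (B ((k + 1) / 2)) ψ

theorem chainVec_even (n : ℕ) (A : ℕ → HA →L[ℂ] HA) (B : ℕ → HB →L[ℂ] HB) (ψ : Joint HA HB)
    (i : ℕ) : chainVec n A B ψ (2 * i) = onA (wrap n A (i + 1)) ψ := by
  rw [chainVec, if_pos (even_two_mul i), Nat.mul_div_cancel_left _ two_pos]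

theorem chainVec_odd (n : ℕ) (A : ℕ → HA →L[ℂ] HA) (B : ℕ → HB →L[ℂ] HB) (ψ : Joint HA HB)
    (i : ℕ) : chainVec n A B ψ (2 * i + 1) = onB (B (i + 1)) ψ := by
  rw [chainVec, if_neg (by simp), show (2 * i + 1 + 1) / 2 = i + 1 by omega]

theorem chainVec_zero {n : ℕ} (hn : 2 ≤ n) (A : ℕ → HA →L[ℂ] HA) (B : ℕ → HB →L[ℂ] HB)
    (ψ : Joint HA HB) : chainVec n A B ψ 0 = onA (A 1) ψ := by
  have h0 := chainVec_even n A B ψ 0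
  rw [mul_zero] at h0
  rw [h0, wrap, if_neg (by omega)]

theorem chainVec_two_mul {n : ℕ} (hn : 2 ≤ n) (A : ℕ → HA →L[ℂ] HA) (B : ℕ → HB →L[ℂ] HB)
    (ψ : Joint HA HB) : chainVec n A B ψ (2 * n) = -chainVec n A B ψ 0 := by
  have h0 := chainVec_even n A B ψ 0
  rw [mul_zero] at h0
  rw [chainVec_even, h0, wrap, wrap, if_pos rfl, if_neg (by omega), onA_neg]
  rfl

theorem sum_range_two_mul (f : ℕ → ℝ) (n : ℕ) :
    ∑ k ∈ Finset.range (2 * n), f k = ∑ i ∈ Finset.range n, (f (2 * i) + f (2 * i + 1)) := by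
  induction n with
  | zero => simp
  | succ n ih =>
    rw [Nat.mul_succ, Finset.sum_range_succ, Finset.sum_range_succ, ih, Finset.sum_range_succ,
      add_assoc]

variable [CompleteSpace HA] [CompleteSpace HB] {n : ℕ} {A : ℕ → HA →L[ℂ] HA}
  {B : ℕ → HB →L[ℂ] HB} {ψ : Joint HA HB} {ε : ℝ}

theorem IsBinaryObservable.neg {E : Type*} [NormedAddCommGroup E] [InnerProductSpace ℂ E]
    [CompleteSpace E] {T : E →L[ℂ] E} (hT : IsBinaryObservable T) : IsBinaryObservable (-T) :=
  ⟨hT.1.neg, by rw [neg_mul_neg, hT.2]⟩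

theorem isBinaryObservable_wrap (hn : 2 ≤ n)
    (hA : ∀ i ∈ Finset.Icc 1 n, IsBinaryObservable (A i)) {i : ℕ} (hi : i ≤ n) :
    IsBinaryObservable (wrap n A (i + 1)) := by
  rw [wrap]
  split_ifs with h
  · exact (hA 1 (Finset.mem_Icc.2 ⟨le_rfl, by omega⟩)).neg
  · exact hA _ (Finset.mem_Icc.2 ⟨by omega, by omega⟩)

theorem inner_tensorOp_apply (S : HA →L[ℂ] HA) {T : HB →L[ℂ] HB} (hS : IsBinaryObservable S) :
    (inner ℂ ψ (tensorOp S T ψ) : ℂ) = inner ℂ (onA S ψ) (onB T ψ) := by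
  rw [inner_apply_of_isSelfAdjoint hS.onA.1, ← mul_apply_eq_comp, onA_mul_onB]

theorem chainVec_energy (hn : 2 ≤ n) (hA : ∀ i ∈ Finset.Icc 1 n, IsBinaryObservable (A i))
    (hB : ∀ j ∈ Finset.Icc 1 n, IsBinaryObservable (B j)) (hψ : ‖ψ‖ = 1)
    (hbell : bellValue n A B ψ = ((bellMax n - ε : ℝ) : ℂ)) :
    ∑ k ∈ Finset.range (2 * n), edgeEnergy (Real.pi / (2 * n)) (chainVec n A B ψ k)
      (chainVec n A B ψ (k + 1)) = 2 * ε := by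
  have hnA (i : ℕ) (hi : i ≤ n) : ‖onA (wrap n A (i + 1)) ψ‖ = 1 := by
    rw [(isBinaryObservable_wrap hn hA hi).onA.norm_apply, hψ]
  have hnB (i : ℕ) (hi : i < n) : ‖onB (B (i + 1)) ψ‖ = 1 := by
    rw [(hB _ (Finset.mem_Icc.2 ⟨by omega, by omega⟩)).onB.norm_apply, hψ]
  have hterm : ∀ i ∈ Finset.range n,
      edgeEnergy (Real.pi / (2 * n)) (chainVec n A B ψ (2 * i)) (chainVec n A B ψ (2 * i + 1)) +
        edgeEnergy (Real.pi / (2 * n)) (chainVec n A B ψ (2 * i + 1))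
          (chainVec n A B ψ (2 * i + 1 + 1)) =
      4 * Real.cos (Real.pi / (2 * n)) - 2 * (inner ℂ ψ ((tensorOp (A (1 + i)) (B (1 + i)) +
        tensorOp (wrap n A (1 + i + 1)) (B (1 + i))) ψ)).re := by
    intro i hi
    have hi := Finset.mem_range.1 hi
    have hw : wrap n A (i + 1) = A (i + 1) := if_neg (by omega)
    have e1 := inner_tensorOp_apply (ψ := ψ) (A (i + 1)) (T := B (i + 1))
      (hA _ (Finset.mem_Icc.2 ⟨by omega, by omega⟩))
    have e2 := inner_tensorOp_apply (ψ := ψ) (wrap n A (i + 1 + 1)) (T := B (i + 1))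
      (isBinaryObservable_wrap hn hA (by omega))
    have e3 : (inner ℂ (onB (B (i + 1)) ψ) (onA (wrap n A (i + 1 + 1)) ψ)).re =
        (inner ℂ (onA (wrap n A (i + 1 + 1)) ψ) (onB (B (i + 1)) ψ)).re :=
      inner_re_symm (𝕜 := ℂ) _ _
    have hA1 := hnA i hi.le
    rw [show 2 * i + 1 + 1 = 2 * (i + 1) by ring, chainVec_even, chainVec_even, chainVec_odd,
      edgeEnergy, edgeEnergy, hnA (i + 1) hi, hnA i hi.le, hnB i hi, hw, e3, add_comm 1 i,
      add_apply, inner_add_right, e1, e2, Complex.add_re]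
    ring
  have hre := congrArg Complex.re hbell
  rw [bellValue, bellOp, Complex.ofReal_re, bellMax, sum_apply, inner_sum,
    Complex.re_sum, ← Finset.Ico_add_one_right_eq_Icc, Finset.sum_Ico_eq_sum_range,
    add_tsub_cancel_right] at hre
  rw [sum_range_two_mul, Finset.sum_congr rfl hterm, Finset.sum_sub_distrib, Finset.sum_const,
    ← Finset.mul_sum, hre, Finset.card_range, nsmul_eq_mul]
  ring

theorem swapObservables_regularize (n : ℕ) (A : ℕ → HA →L[ℂ] HA) (B : ℕ → HB →L[ℂ] HB) :
    SwapObservables (H := Joint HA HB) (onA (regularize (XA n A))) (onA (regularize (ZA A)))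
      (onB (regularize (XB n B))) (onB (regularize (ZB n B))) where
  x := (isBinaryObservable_regularize _).onA
  z := (isBinaryObservable_regularize _).onA
  x' := (isBinaryObservable_regularize _).onB
  z' := (isBinaryObservable_regularize _).onB
  xx := commute_onA_onB _ _
  xz := commute_onA_onB _ _
  zx := commute_onA_onB _ _
  zz := commute_onA_onB _ _

theorem isSelfAdjoint_real_smul {E : Type*} [NormedAddCommGroup E] [InnerProductSpace ℂ E]
    [CompleteSpace E] (r : ℝ) {T : E →L[ℂ] E} (hT : IsSelfAdjoint T) :
    IsSelfAdjoint ((r : ℂ) • T) := by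
  rw [IsSelfAdjoint, star_smul, hT.star_eq, Complex.star_def, Complex.conj_ofReal]

theorem regularize_ZA (hn : 2 ≤ n) (hA : ∀ i ∈ Finset.Icc 1 n, IsBinaryObservable (A i)) :
    regularize (ZA A) = A 1 :=
  regularize_eq_self (hA 1 (Finset.mem_Icc.2 ⟨le_rfl, by omega⟩))

theorem norm_ZA_sub_ZB_le (hn : 2 ≤ n) (hA : ∀ i ∈ Finset.Icc 1 n, IsBinaryObservable (A i))
    (hB : ∀ j ∈ Finset.Icc 1 n, IsBinaryObservable (B j)) (hψ : ‖ψ‖ = 1)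
    (hbell : bellValue n A B ψ = ((bellMax n - ε : ℝ) : ℂ)) :
    ‖onA (regularize (ZA A)) ψ - onB (regularize (ZB n B)) ψ‖ ≤ 2 * √(eps1 ε n) := by
  have h := norm_start_sub_neighbours_le hn (chainVec_two_mul hn A B ψ)
    (chainVec_energy hn hA hB hψ hbell)
  have hA1 := hA 1 (Finset.mem_Icc.2 ⟨le_rfl, by omega⟩)
  have hB1 := hB 1 (Finset.mem_Icc.2 ⟨le_rfl, by omega⟩)
  have hBn := hB n (Finset.mem_Icc.2 ⟨by omega, le_rfl⟩)
  have e1 := chainVec_odd n A B ψ 0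
  have e2 := chainVec_odd n A B ψ (n - 1)
  rw [mul_zero, zero_add] at e1
  rw [show 2 * (n - 1) + 1 = 2 * n - 1 by omega, show n - 1 + 1 = n by omega] at e2
  have e3 : (((2 * Real.cos (Real.pi / (2 * n)))⁻¹ : ℝ) : ℂ) •
      (onB (B 1) ψ - onB (B n) ψ) = onB (ZB n B) ψ := by
    rw [ZB, onB_smul, onB_sub]
    rfl
  rw [chainVec_zero hn A B ψ, e1, e2, e3] at h
  have h2 := norm_regularize_sub_le_onB hA1 (M := ZB n B)
    (isSelfAdjoint_real_smul _ (hB1.1.sub hBn.1)) ψ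
  rw [regularize_ZA hn hA]
  have h3 := norm_sub_le_norm_sub_add_norm_sub (onA (A 1) ψ) (onB (ZB n B) ψ)
    (onB (regularize (ZB n B)) ψ)
  rw [norm_sub_rev (onB (ZB n B) ψ)] at h3
  linarith

/-- The error made by taking Alice's operator `X` at the angle `π / 2`. -/
def middleErr (ε : ℝ) (n : ℕ) : ℝ := if Even n then 0 else 2 * √(eps1 ε n)

theorem norm_XA_sub_XB_le (hn : 2 ≤ n) (hA : ∀ i ∈ Finset.Icc 1 n, IsBinaryObservable (A i))
    (hB : ∀ j ∈ Finset.Icc 1 n, IsBinaryObservable (B j)) (hψ : ‖ψ‖ = 1)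
    (hbell : bellValue n A B ψ = ((bellMax n - ε : ℝ) : ℂ)) :
    ‖onA (regularize (XA n A)) ψ - onB (regularize (XB n B)) ψ‖ ≤ 2 * √(eps1 ε n) ∧
      ‖chainVec n A B ψ n - onA (regularize (XA n A)) ψ‖ ≤ middleErr ε n := by
  have h := norm_middle_sub_neighbours_le hn (chainVec_two_mul hn A B ψ)
    (chainVec_energy hn hA hB hψ hbell)
  rw [middleErr]
  rcases Nat.even_or_odd' n with ⟨m, hm | hm⟩
  · have hev : Even n := ⟨m, by omega⟩
    have hdiv : n / 2 = m := by omega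
    have hAm := hA (m + 1) (Finset.mem_Icc.2 ⟨by omega, by omega⟩)
    have hB1 := hB m (Finset.mem_Icc.2 ⟨by omega, by omega⟩)
    have hB2 := hB (m + 1) (Finset.mem_Icc.2 ⟨by omega, by omega⟩)
    have e0 : chainVec n A B ψ n = onA (A (m + 1)) ψ := by
      have := chainVec_even n A B ψ m
      rwa [← hm, wrap, if_neg (by omega)] at this
    have e1 : chainVec n A B ψ (n - 1) = onB (B m) ψ := by
      have := chainVec_odd n A B ψ (m - 1)
      rwa [show 2 * (m - 1) + 1 = n - 1 by omega, show m - 1 + 1 = m by omega] at this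
    have e2 : chainVec n A B ψ (n + 1) = onB (B (m + 1)) ψ := by
      have := chainVec_odd n A B ψ m
      rwa [← hm] at this
    have e3 : (((2 * Real.cos (Real.pi / (2 * n)))⁻¹ : ℝ) : ℂ) •
        (onB (B m) ψ + onB (B (m + 1)) ψ) = onB (XB n B) ψ := by
      rw [XB, if_pos hev, onB_smul, onB_add, hdiv]
      rfl
    have hX : XA n A = A (m + 1) := by rw [XA, if_pos hev, hdiv]
    rw [e0, e1, e2, e3] at h
    have h2 := norm_regularize_sub_le_onB hAm (M := XB n B)
      (by rw [XB, if_pos hev, hdiv]; exact isSelfAdjoint_real_smul _ (hB1.1.add hB2.1)) ψ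
    rw [if_pos hev, hX, regularize_eq_self hAm, e0, sub_self, norm_zero]
    have h3 := norm_sub_le_norm_sub_add_norm_sub (onA (A (m + 1)) ψ) (onB (XB n B) ψ)
      (onB (regularize (XB n B)) ψ)
    rw [norm_sub_rev (onB (XB n B) ψ)] at h3
    exact ⟨by linarith, le_rfl⟩
  · have hev : ¬Even n := Nat.not_even_iff_odd.2 ⟨m, hm⟩
    have hd1 : (n + 1) / 2 = m + 1 := by omega
    have hd3 : (n + 3) / 2 = m + 2 := by omega
    have hBm := hB (m + 1) (Finset.mem_Icc.2 ⟨by omega, by omega⟩)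
    have hA1 := hA (m + 1) (Finset.mem_Icc.2 ⟨by omega, by omega⟩)
    have hA2 := hA (m + 2) (Finset.mem_Icc.2 ⟨by omega, by omega⟩)
    have e0 : chainVec n A B ψ n = onB (B (m + 1)) ψ := by
      have := chainVec_odd n A B ψ m
      rwa [← hm] at this
    have e1 : chainVec n A B ψ (n - 1) = onA (A (m + 1)) ψ := by
      have := chainVec_even n A B ψ m
      rwa [show 2 * m = n - 1 by omega, wrap, if_neg (by omega)] at this
    have e2 : chainVec n A B ψ (n + 1) = onA (A (m + 2)) ψ := by
      have := chainVec_even n A B ψ (m + 1)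
      rwa [show 2 * (m + 1) = n + 1 by omega, wrap, if_neg (by omega)] at this
    have e3 : (((2 * Real.cos (Real.pi / (2 * n)))⁻¹ : ℝ) : ℂ) •
        (onA (A (m + 1)) ψ + onA (A (m + 2)) ψ) = onA (XA n A) ψ := by
      rw [XA, if_neg hev, onA_smul, onA_add, hd1, hd3]
      rfl
    have hX : XB n B = B (m + 1) := by rw [XB, if_neg hev, hd1]
    rw [e0, e1, e2, e3] at h
    have h2 := norm_regularize_sub_le_onA hBm (M := XA n A)
      (by rw [XA, if_neg hev, hd1, hd3]; exact isSelfAdjoint_real_smul _ (hA1.1.add hA2.1)) ψ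
    have h3 := norm_sub_le_norm_sub_add_norm_sub (onB (B (m + 1)) ψ) (onA (XA n A) ψ)
      (onA (regularize (XA n A)) ψ)
    rw [norm_sub_rev (onA (XA n A) ψ)] at h3
    rw [if_neg hev, hX, regularize_eq_self hBm, e0, norm_sub_rev (onA (regularize (XA n A)) ψ)]
    exact ⟨by linarith, by linarith⟩

theorem norm_chainVec_sub_obs_le (hn : 2 ≤ n)
    (hA : ∀ i ∈ Finset.Icc 1 n, IsBinaryObservable (A i))
    (hB : ∀ j ∈ Finset.Icc 1 n, IsBinaryObservable (B j)) (hψ : ‖ψ‖ = 1)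
    (hbell : bellValue n A B ψ = ((bellMax n - ε : ℝ) : ℂ)) {k : ℕ} (hk : k ≤ 2 * n) :
    ‖chainVec n A B ψ k - obs (onA (regularize (XA n A))) (onA (regularize (ZA A)))
        (k * (Real.pi / (2 * n))) ψ‖ ≤
      √(ε * |Real.sin (2 * (k * (Real.pi / (2 * n))))| / Real.sin (Real.pi / (2 * n))) +
        middleErr ε n := by
  have h1 := norm_sub_planar_le hn (chainVec_two_mul hn A B ψ)
    (chainVec_energy hn hA hB hψ hbell) hk
  have h2 := (norm_XA_sub_XB_le hn hA hB hψ hbell).2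
  have e : planar n (chainVec n A B ψ) k - obs (onA (regularize (XA n A)))
      (onA (regularize (ZA A))) (k * (Real.pi / (2 * n))) ψ =
      (Real.sin (k * (Real.pi / (2 * n))) : ℂ) •
        (chainVec n A B ψ n - onA (regularize (XA n A)) ψ) := by
    rw [planar, obs_apply, chainVec_zero hn A B ψ, regularize_ZA hn hA]
    module
  refine (norm_sub_le_norm_sub_add_norm_sub _ (planar n (chainVec n A B ψ) k) _).trans ?_
  rw [e, norm_smul, Complex.norm_real, Real.norm_eq_abs]
  refine add_le_add h1 ((mul_le_of_le_one_left (norm_nonneg _) (Real.abs_sin_le_one _)).trans h2)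

theorem norm_anticommutator_le (hn : 2 ≤ n)
    (hA : ∀ i ∈ Finset.Icc 1 n, IsBinaryObservable (A i))
    (hB : ∀ j ∈ Finset.Icc 1 n, IsBinaryObservable (B j)) (hψ : ‖ψ‖ = 1)
    (hbell : bellValue n A B ψ = ((bellMax n - ε : ℝ) : ℂ)) {j : ℕ} (hj : j < n) {S : ℝ}
    (hS : 0 < S) (hS' : |Real.sin (2 * ((2 * j + 1 : ℕ) * (Real.pi / (2 * n))))| = S) :
    ‖onA (regularize (XA n A)) (onA (regularize (ZA A)) ψ) +
        onA (regularize (ZA A)) (onA (regularize (XA n A)) ψ)‖ ≤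
      2 * ((1 + √2) * (√(ε / (S * Real.sin (Real.pi / (2 * n)))) + middleErr ε n / S)) := by
  have hs := sin_angle_pos hn
  have h := norm_chainVec_sub_obs_le hn hA hB hψ hbell (k := 2 * j + 1) (by omega)
  rw [chainVec_odd] at h
  have h2 := anticommutator_le (isBinaryObservable_regularize _).onA
    (isBinaryObservable_regularize _).onA (hB _ (Finset.mem_Icc.2 ⟨by omega, by omega⟩)).onB
    (commute_onA_onB _ _) (commute_onA_onB _ _) h
  rw [hS'] at h2
  refine le_of_mul_le_mul_left (h2.trans_eq ?_) hS
  have e1 : √(ε * S / Real.sin (Real.pi / (2 * n))) =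
      S * √(ε / (S * Real.sin (Real.pi / (2 * n)))) := by
    rw [show ε * S / Real.sin (Real.pi / (2 * n)) =
      S ^ 2 * (ε / (S * Real.sin (Real.pi / (2 * n)))) by field_simp,
      Real.sqrt_mul (by positivity), Real.sqrt_sq hS.le]
  rw [e1]
  field_simp

/-- The four distances of the self-testing statement in terms of bounds `η` for the distance of the
vectors `A i ψ` and `B j ψ` from the plane and `ω` for the anticommutator. -/
theorem self_test_bounds (hn : 2 ≤ n) (hA : ∀ i ∈ Finset.Icc 1 n, IsBinaryObservable (A i))
    (hB : ∀ j ∈ Finset.Icc 1 n, IsBinaryObservable (B j)) (hψ : ‖ψ‖ = 1) (hε : 0 ≤ ε)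
    (hbell : bellValue n A B ψ = ((bellMax n - ε : ℝ) : ℂ)) {ω η : ℝ}
    (hω : ‖onA (regularize (XA n A)) (onA (regularize (ZA A)) ψ) +
        onA (regularize (ZA A)) (onA (regularize (XA n A)) ψ)‖ ≤ ω)
    (hη : √(ε / Real.sin (Real.pi / (2 * n))) + middleErr ε n = η) :
    (∀ i ∈ Finset.Icc 1 n, ∀ j ∈ Finset.Icc 1 n,
      ‖Phi n A B (prodVec (tensorOp (A i) (B j) ψ) ket00) -
        prodVec (junk n A B ψ) ((refA n i ⊗ₖ refB n j).mulVec phiPlus)‖ ≤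
          (1 + √2) * η + (3 + 2 * √2) * ω + 10 * √(eps1 ε n)) ∧
    (∀ i ∈ Finset.Icc 1 n,
      ‖Phi n A B (prodVec (onA (A i) ψ) ket00) -
        prodVec (junk n A B ψ) ((refA n i ⊗ₖ 1).mulVec phiPlus)‖ ≤
          η + 3 * ω + 10 * √(eps1 ε n)) ∧
    (∀ j ∈ Finset.Icc 1 n,
      ‖Phi n A B (prodVec (onB (B j) ψ) ket00) -
        prodVec (junk n A B ψ) ((1 ⊗ₖ refB n j).mulVec phiPlus)‖ ≤
          η + 3 * ω + 10 * √(eps1 ε n)) ∧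
    ‖Phi n A B (prodVec ψ ket00) - prodVec (junk n A B ψ) phiPlus‖ ≤ ω + 10 * √(eps1 ε n) := by
  have hs := sin_angle_pos hn
  have hsw := swapObservables_regularize n A B
  have hxx := (norm_XA_sub_XB_le hn hA hB hψ hbell).1
  have hzz := norm_ZA_sub_ZB_le hn hA hB hψ hbell
  have hPhi (v : Joint HA HB) : Phi n A B (prodVec v ket00) = swapVec (onA (regularize (XA n A)))
      (onA (regularize (ZA A))) (onB (regularize (XB n B))) (onB (regularize (ZB n B))) v :=
    circuit_prodVec_ket00 _ _ _ _ v
  have hjunk : junkUnnormalized n A B ψ = (1 + onA (regularize (ZA A)))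
      ((1 + onB (regularize (ZB n B))) ψ) := by
    rw [junkUnnormalized, onA_add, onB_add, onA_one, onB_one, regularize_ZA hn hA]
    rfl
  have h0 := norm_swapVec_sub_junk_le hsw hψ hxx hzz hω hjunk
  change ‖_ - prodVec (junk n A B ψ) phiPlus‖ ≤ _ at h0
  have hsqrt (x : ℝ) : √(ε * |Real.sin x| / Real.sin (Real.pi / (2 * n))) ≤
      √(ε / Real.sin (Real.pi / (2 * n))) := by
    gcongr
    exact mul_le_of_le_one_right hε (Real.abs_sin_le_one x)
  have hAi (i : ℕ) (hi : i ∈ Finset.Icc 1 n) : ‖onA (A i) ψ - obs (onA (regularize (XA n A)))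
      (onA (regularize (ZA A))) (((i : ℝ) - 1) * Real.pi / n) ψ‖ ≤ η := by
    obtain ⟨hi1, hin⟩ := Finset.mem_Icc.1 hi
    have h := norm_chainVec_sub_obs_le hn hA hB hψ hbell (k := 2 * (i - 1)) (by omega)
    rw [chainVec_even, wrap, if_neg (by omega), show i - 1 + 1 = i by omega] at h
    have e : ((2 * (i - 1) : ℕ) : ℝ) * (Real.pi / (2 * n)) = ((i : ℝ) - 1) * Real.pi / n := by
      rw [Nat.cast_mul, Nat.cast_sub hi1]
      push_cast
      field_simp
    rw [e] at h
    exact h.trans (hη ▸ add_le_add_left (hsqrt _) _)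
  have hBj (j : ℕ) (hj : j ∈ Finset.Icc 1 n) : ‖onB (B j) ψ - obs (onA (regularize (XA n A)))
      (onA (regularize (ZA A))) ((2 * (j : ℝ) - 1) * Real.pi / (2 * n)) ψ‖ ≤ η := by
    obtain ⟨hj1, hjn⟩ := Finset.mem_Icc.1 hj
    have h := norm_chainVec_sub_obs_le hn hA hB hψ hbell (k := 2 * (j - 1) + 1) (by omega)
    rw [chainVec_odd, show j - 1 + 1 = j by omega] at h
    have e : ((2 * (j - 1) + 1 : ℕ) : ℝ) * (Real.pi / (2 * n)) =
        (2 * (j : ℝ) - 1) * Real.pi / (2 * n) := by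
      push_cast [Nat.cast_sub hj1]
      ring
    rw [e] at h
    exact h.trans (hη ▸ add_le_add_left (hsqrt _) _)
  have hB1 (j : ℕ) (hj : j ∈ Finset.Icc 1 n) := norm_swapVec_sub_ancGate_le hsw (hBj j hj) hω h0
  have hA1 (i : ℕ) (hi : i ∈ Finset.Icc 1 n) := norm_swapVec_sub_ancGate_le hsw (hAi i hi) hω h0
  simp only [ancGate_prodVec] at hA1 hB1
  refine ⟨fun i hi j hj => ?_, fun i hi => ?_, fun j hj => ?_, ?_⟩
  · have hη0 : ‖obs (onA (regularize (XA n A))) (onA (regularize (ZA A)))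
        ((2 * (j : ℝ) - 1) * Real.pi / (2 * n)) ψ - obs (onA (regularize (XA n A)))
          (onA (regularize (ZA A))) ((2 * (j : ℝ) - 1) * Real.pi / (2 * n)) ψ‖ ≤ 0 := by simp
    have h1 := norm_swapVec_sub_ancGate_le hsw hη0 hω h0
    have h2 := norm_mul_sub_obs_obs_le hsw.x hsw.z (hB j hj).onB (commute_onA_onB _ _)
      (commute_onA_onB _ _) (commute_onA_onB _ _) (hAi i hi) (hBj j hj)
    have h3 := norm_swapVec_sub_ancGate_le hsw h2
      (norm_anticommutator_obs_le hsw.x hsw.z hω _) h1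
    rw [ancGate_prodVec, ancGate_prodVec, ← pauliXZ_kronecker_mulVec_phiPlus,
      ← mul_apply_eq_comp, onA_mul_onB] at h3
    rw [hPhi]
    exact h3.trans (by linarith)
  · rw [hPhi]
    exact (hA1 i hi).trans (by linarith)
  · rw [hPhi, refB, pauliXZ_mulVec_phiPlus]
    exact (hB1 j hj).trans (by linarith)
  · rw [hPhi]
    exact h0.trans (by linarith)

end Experiment

section Asymptotics

variable {n : ℕ} {ε : ℝ}

theorem inv_le_sin_angle (hn : 2 ≤ n) : 1 / (n : ℝ) ≤ Real.sin (Real.pi / (2 * n)) := by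
  have h := Real.mul_le_sin (angle_pos hn).le ((angle_le hn).trans (by linarith [Real.pi_pos]))
  refine le_trans (le_of_eq ?_) h
  have := Real.pi_pos
  field_simp

theorem seven_tenths_le_cos_angle (hn : 2 ≤ n) : 7 / 10 ≤ Real.cos (Real.pi / (2 * n)) := by
  have h := sqrt_two_div_two_le_cos_angle hn
  have h2 : (1.4 : ℝ) ≤ √2 := Real.le_sqrt_of_sq_le (by norm_num)
  linarith

theorem sin_angle_le_cos_angle (hn : 2 ≤ n) :
    Real.sin (Real.pi / (2 * n)) ≤ Real.cos (Real.pi / (2 * n)) := by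
  rw [← Real.cos_pi_div_two_sub]
  have h := angle_le hn
  have h' := angle_pos hn
  exact Real.cos_le_cos_of_nonneg_of_le_pi h'.le (by linarith [Real.pi_pos]) (by linarith)

theorem sqrt_eps1 (hε : 0 ≤ ε) : √(eps1 ε n) = √ε / √(Real.cos (Real.pi / (2 * n))) := by
  rw [eps1, Real.sqrt_div hε]

theorem four_fifths_le_sqrt_cos_angle (hn : 2 ≤ n) : 4 / 5 ≤ √(Real.cos (Real.pi / (2 * n))) :=
  Real.le_sqrt_of_sq_le (by linarith [seven_tenths_le_cos_angle hn])

theorem sqrt_eps1_le' (hn : 2 ≤ n) (hε : 0 ≤ ε) : √(eps1 ε n) ≤ 5 / 4 * √ε := by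
  have hc := four_fifths_le_sqrt_cos_angle hn
  rw [sqrt_eps1 hε, div_le_iff₀ (by linarith)]
  nlinarith [Real.sqrt_nonneg ε]

theorem sqrt_eps1_le (hn : 2 ≤ n) (hε : 0 ≤ ε) : √(eps1 ε n) ≤ 2 * √ε := by
  linarith [sqrt_eps1_le' hn hε, Real.sqrt_nonneg ε]

theorem sqrt_two_mul_eps2 (hn : 2 ≤ n) :
    √(2 * eps2 ε n) = 4 * (√(Real.cos (Real.pi / (2 * n))) * √ε) := by
  rw [eps2, ← Real.sqrt_mul (cos_angle_pos hn).le,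
    show 2 * (8 * Real.cos (Real.pi / (2 * n)) * ε) =
      4 ^ 2 * (Real.cos (Real.pi / (2 * n)) * ε) by ring,
    Real.sqrt_mul (by norm_num), Real.sqrt_sq (by norm_num)]

theorem xi_half (hn : 2 ≤ n) (hev : Even n) :
    xi n (n / 2 - 1) = 2 * Real.sin (Real.pi / (2 * n)) := by
  obtain ⟨m, hm⟩ := hev
  have hm1 : 1 ≤ m := by omega
  have h : n / 2 - 1 = m - 1 := by omega
  have hn' : (n : ℝ) = 2 * m := by rw [hm]; push_cast; ring
  have hm0 : (0 : ℝ) < m := by exact_mod_cast hm1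
  rw [xi, h, ← Real.cos_pi_div_two_sub, Nat.cast_sub hm1, Nat.cast_one]
  congr 2
  rw [hn']
  field_simp
  ring

theorem sin_pi_div_nonneg (n : ℕ) : 0 ≤ Real.sin (Real.pi / n) := by
  rcases Nat.eq_zero_or_pos n with rfl | h
  · simp
  · have : (1 : ℝ) ≤ n := by exact_mod_cast h
    exact Real.sin_nonneg_of_nonneg_of_le_pi (by positivity)
      (div_le_self Real.pi_pos.le this)

theorem alpha_nonneg (hn : 2 ≤ n) (m : ℕ) : 0 ≤ alpha n m := by
  have := cos_angle_pos hn
  have := sin_pi_div_nonneg n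
  rw [alpha]
  positivity

theorem gamma_nonneg (hn : 2 ≤ n) (m : ℕ) : 0 ≤ gamma n m := by
  have := cos_angle_pos hn
  rw [gamma]
  positivity

theorem omegaEv_ge (hn : 2 ≤ n) (hev : Even n) :
    √2 * √(eps1 ε n) + 2 * n * (√(Real.cos (Real.pi / (2 * n))) * √ε) /
      Real.sin (Real.pi / (2 * n)) ≤ omegaEv ε n := by
  have hs := sin_angle_pos hn
  rw [omegaEv, xi_half hn hev, sqrt_two_mul_eps2 hn, Real.sqrt_mul (by norm_num)]
  have h : 0 ≤ if n = 2 then 0 else 4 * √(eps1 ε n) / alpha n (n / 2 - 1) := by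
    have := alpha_nonneg hn (n / 2 - 1)
    split_ifs <;> positivity
  have h2 : 2 * n * (√(Real.cos (Real.pi / (2 * n))) * √ε) / Real.sin (Real.pi / (2 * n)) =
      1 / (2 * Real.sin (Real.pi / (2 * n))) *
        (n * (4 * (√(Real.cos (Real.pi / (2 * n))) * √ε))) := by
    field_simp
    ring
  rw [h2]
  gcongr
  linarith

theorem sin_pi_div_eq (n : ℕ) : Real.sin (Real.pi / n) =
    2 * Real.sin (Real.pi / (2 * n)) * Real.cos (Real.pi / (2 * n)) := by
  rw [← Real.sin_two_mul]
  congr 1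
  ring

theorem inv_le_sin_pi_div (hn : 2 ≤ n) : 1 / (n : ℝ) ≤ Real.sin (Real.pi / n) := by
  have h1 := inv_le_sin_angle hn
  have h2 := seven_tenths_le_cos_angle hn
  have h3 := sin_angle_pos hn
  rw [sin_pi_div_eq]
  nlinarith

theorem one_div_alpha_le (hn : 2 ≤ n) (m : ℕ) : 1 / alpha n m ≤ n := by
  have hc := cos_angle_pos hn
  have hs := inv_le_sin_angle hn
  have hn0 : (0 : ℝ) < n := by exact_mod_cast (by omega : 0 < n)
  have hs0 := sin_angle_pos hn
  set P := Real.sin (Real.pi * m / n) * Real.sin (Real.pi * (m + 1) / n) with hP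
  have hP1 : √P ≤ 1 := by
    refine Real.sqrt_le_one.2 ?_
    have h1 := abs_le.1 (Real.abs_sin_le_one (Real.pi * m / n))
    have h2 := abs_le.1 (Real.abs_sin_le_one (Real.pi * (m + 1) / n))
    rw [hP]
    nlinarith
  have e : 1 / alpha n m = √P / Real.sin (Real.pi / (2 * n)) := by
    rw [alpha, ← hP, sin_pi_div_eq, Real.sqrt_div zero_le_one, Real.sqrt_one]
    field_simp
  rw [e, div_le_iff₀ hs0]
  refine hP1.trans ?_
  rwa [div_le_iff₀' hn0] at hs

theorem one_div_alpha_one_le (hn : 2 ≤ n) : 1 / alpha n 1 ≤ 3 := by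
  have hc := cos_angle_pos hn
  have hs0 := sin_angle_pos hn
  have hsn : 0 < Real.sin (Real.pi / n) := by
    rw [sin_pi_div_eq]
    positivity
  have e : √(Real.sin (Real.pi * (1 : ℕ) / n) * Real.sin (Real.pi * ((1 : ℕ) + 1) / n)) =
      Real.sin (Real.pi / n) * √(2 * Real.cos (Real.pi / n)) := by
    have e1 : Real.pi * ((1 : ℕ) + 1) / n = 2 * (Real.pi / n) := by push_cast; ring
    rw [e1, Real.sin_two_mul, Nat.cast_one, mul_one,
      show Real.sin (Real.pi / n) * (2 * Real.sin (Real.pi / n) * Real.cos (Real.pi / n)) =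
        Real.sin (Real.pi / n) ^ 2 * (2 * Real.cos (Real.pi / n)) by ring,
      Real.sqrt_mul (by positivity), Real.sqrt_sq hsn.le]
  have h : √(2 * Real.cos (Real.pi / n)) ≤ 3 / 2 := by
    rw [Real.sqrt_le_left (by norm_num)]
    linarith [Real.cos_le_one (Real.pi / n)]
  have e2 : 1 / alpha n 1 = 2 * Real.cos (Real.pi / (2 * n)) * √(2 * Real.cos (Real.pi / n)) := by
    rw [alpha, Real.sqrt_div zero_le_one, Real.sqrt_one, e]
    field_simp
  rw [e2]
  have := Real.cos_le_one (Real.pi / (2 * n))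
  have := Real.sqrt_nonneg (2 * Real.cos (Real.pi / n))
  nlinarith

theorem gamma_le (hn : 2 ≤ n) {m : ℕ} (hm : m + 2 ≤ n) : gamma n m ≤ n := by
  have hc := seven_tenths_le_cos_angle hn
  have hn2 : (2 : ℝ) ≤ n := by exact_mod_cast hn
  have hm2 : (m : ℝ) + 2 ≤ n := by exact_mod_cast hm
  have hpi := Real.pi_pos
  have hx1 : Real.pi / n ≤ Real.pi * (m + 1) / n := by
    gcongr
    exact le_mul_of_one_le_right hpi.le (by linarith [Nat.cast_nonneg (α := ℝ) m])
  have hx2 : Real.pi * (m + 1) / n ≤ Real.pi - Real.pi / n := by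
    rw [div_le_iff₀ (by linarith), sub_mul, div_mul_cancel₀ _ (by linarith)]
    nlinarith
  have hpn : Real.pi / n ≤ Real.pi / 2 := by gcongr
  have hpn0 : 0 < Real.pi / n := by positivity
  have hsin : Real.sin (Real.pi / n) ≤ Real.sin (Real.pi * (m + 1) / n) := by
    rcases le_total (Real.pi * (m + 1) / n) (Real.pi / 2) with h | h
    · exact Real.sin_le_sin_of_le_of_le_pi_div_two (by linarith) h hx1
    · rw [← Real.sin_pi_sub (Real.pi * (m + 1) / n)]
      exact Real.sin_le_sin_of_le_of_le_pi_div_two (by linarith) (by linarith) (by linarith)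
  have h1 := (inv_le_sin_pi_div hn).trans hsin
  have hq : Real.sin (Real.pi * m / n) / Real.sin (Real.pi * (m + 1) / n) ≤ n := by
    have h0 : 0 < Real.sin (Real.pi * (m + 1) / n) := lt_of_lt_of_le (by positivity) h1
    rw [div_le_iff₀ h0]
    refine (Real.sin_le_one _).trans ?_
    rwa [div_le_iff₀' (by linarith)] at h1
  have hsq : √(Real.sin (Real.pi * m / n) / Real.sin (Real.pi * (m + 1) / n)) ≤ n :=
    (Real.sqrt_le_left (by linarith)).2 (by nlinarith)
  rw [gamma]
  have h3 : 1 / (2 * Real.cos (Real.pi / (2 * n))) ≤ 1 := by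
    rw [div_le_one (by linarith)]
    linarith
  calc _ ≤ 1 * (n : ℝ) := by gcongr
    _ = n := one_mul _

theorem omegaEv_le (hn : 2 ≤ n) (hev : Even n) (hε : 0 ≤ ε) :
    omegaEv ε n ≤ 8 * (n : ℝ) ^ 2 * √ε := by
  have h1 := sqrt_eps1_le hn hε
  have hs := inv_le_sin_angle hn
  have hs0 := sin_angle_pos hn
  have hn2 : (2 : ℝ) ≤ n := by exact_mod_cast hn
  have hroot := Real.sqrt_nonneg ε
  have h2 : √2 ≤ 3 / 2 := (Real.sqrt_le_left (by norm_num)).2 (by norm_num)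
  have hcos : √(Real.cos (Real.pi / (2 * n))) ≤ 1 :=
    Real.sqrt_le_one.2 (Real.cos_le_one _)
  have hif : (if n = 2 then 0 else 4 * √(eps1 ε n) / alpha n (n / 2 - 1)) ≤ 8 * (n * √ε) := by
    split_ifs
    · positivity
    · have h4 := one_div_alpha_le hn (n / 2 - 1)
      have h5 := alpha_nonneg hn (n / 2 - 1)
      calc 4 * √(eps1 ε n) / alpha n (n / 2 - 1) =
          4 * √(eps1 ε n) * (1 / alpha n (n / 2 - 1)) := by ring
        _ ≤ 4 * (2 * √ε) * n := by
            gcongr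
        _ = _ := by ring
  have hxi : 1 / (2 * Real.sin (Real.pi / (2 * n))) ≤ n / 2 := by
    rw [div_le_div_iff₀ (by positivity) two_pos]
    rw [div_le_iff₀' (by linarith)] at hs
    linarith
  have hcos' : √(Real.cos (Real.pi / (2 * n))) * √ε ≤ √ε := mul_le_of_le_one_left hroot hcos
  rw [omegaEv, xi_half hn hev, sqrt_two_mul_eps2 hn, Real.sqrt_mul (by norm_num)]
  calc √2 * √(eps1 ε n) + 1 / (2 * Real.sin (Real.pi / (2 * n))) *
        ((if n = 2 then 0 else 4 * √(eps1 ε n) / alpha n (n / 2 - 1)) +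
          n * (4 * (√(Real.cos (Real.pi / (2 * n))) * √ε)))
      ≤ 3 / 2 * (2 * √ε) + n / 2 * (8 * (n * √ε) + n * (4 * √ε)) := by
        have hnn : 0 ≤ if n = 2 then 0 else 4 * √(eps1 ε n) / alpha n (n / 2 - 1) := by
          have := alpha_nonneg hn (n / 2 - 1)
          split_ifs <;> positivity
        gcongr
    _ = (3 + 6 * (n : ℝ) ^ 2) * √ε := by ring
    _ ≤ 8 * (n : ℝ) ^ 2 * √ε := by
        gcongr
        nlinarith

theorem factor_nonneg (hn : 2 ≤ n) (m : ℕ) :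
    0 ≤ (1 + gamma n m / (2 * alpha n 1)) * (√(eps1 ε n) / alpha n m) := by
  have := alpha_nonneg hn m
  have := alpha_nonneg hn 1
  have := gamma_nonneg hn m
  positivity

theorem factor_le (hn : 2 ≤ n) (hε : 0 ≤ ε) {m : ℕ} (hm : m + 2 ≤ n) :
    (1 + gamma n m / (2 * alpha n 1)) * (√(eps1 ε n) / alpha n m) ≤ 4 * (n : ℝ) ^ 2 * √ε := by
  have hn2 : (2 : ℝ) ≤ n := by exact_mod_cast hn
  have h1 := alpha_nonneg hn m
  have h2 := alpha_nonneg hn 1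
  have h3 := gamma_nonneg hn m
  have h4 := gamma_le hn hm
  have h5 := one_div_alpha_le hn m
  have h6 := one_div_alpha_one_le hn
  have h7 := sqrt_eps1_le hn hε
  have hroot := Real.sqrt_nonneg ε
  calc (1 + gamma n m / (2 * alpha n 1)) * (√(eps1 ε n) / alpha n m)
      = (1 + gamma n m * (1 / alpha n 1) / 2) * (√(eps1 ε n) * (1 / alpha n m)) := by ring
    _ ≤ (1 + n * 3 / 2) * (2 * √ε * n) := by gcongr
    _ = (2 * n + 3 * (n : ℝ) ^ 2) * √ε := by ring
    _ ≤ 4 * (n : ℝ) ^ 2 * √ε := by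
        gcongr
        nlinarith

theorem gEv_nonneg (hn : 2 ≤ n) (i : ℕ) : 0 ≤ gEv ε n i := by
  have h1 := factor_nonneg (ε := ε) hn (Nat.dist (n / 2 + 1) i)
  have h2 := factor_nonneg (ε := ε) hn (i - 1)
  rw [gEv]
  split_ifs <;> positivity

theorem gEv_le (hn : 2 ≤ n) (hε : 0 ≤ ε) {i : ℕ} (hi : i ∈ Finset.Icc 1 n) :
    gEv ε n i ≤ 8 * (n : ℝ) ^ 2 * √ε := by
  obtain ⟨hi1, hin⟩ := Finset.mem_Icc.1 hi
  have hn2 : (2 : ℝ) ≤ n := by exact_mod_cast hn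
  have hroot := Real.sqrt_nonneg ε
  rw [gEv]
  split_ifs with h h'
  · positivity
  · have hd : Nat.dist (n / 2 + 1) i + 2 ≤ n := by rw [Nat.dist]; omega
    have hr : √(eps1 ε n / alpha n 1) / 2 ≤ 4 * (n : ℝ) ^ 2 * √ε := by
      have h1 := one_div_alpha_one_le hn
      have h2 : √(1 / alpha n 1) ≤ 2 := (Real.sqrt_le_left (by norm_num)).2 (by linarith)
      have h3 := sqrt_eps1_le hn hε
      have he : 0 ≤ eps1 ε n := div_nonneg hε (cos_angle_pos hn).le
      calc √(eps1 ε n / alpha n 1) / 2 = √(eps1 ε n) * √(1 / alpha n 1) / 2 := by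
            rw [← Real.sqrt_mul he, mul_one_div]
        _ ≤ (2 * √ε) * 2 / 2 := by gcongr
        _ = 2 * √ε := by ring
        _ ≤ 4 * (n : ℝ) ^ 2 * √ε := by
            gcongr
            nlinarith
    linarith [factor_le hn hε hd]
  · have hd : Nat.dist (n / 2 + 1) i + 2 ≤ n := by rw [Nat.dist]; omega
    have hd' : i - 1 + 2 ≤ n := by omega
    linarith [factor_le hn hε hd, factor_le hn hε hd']

theorem hEv_nonneg (hn : 2 ≤ n) (j : ℕ) : 0 ≤ hEv ε n j := by
  have h1 := alpha_nonneg hn (j - 1)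
  have h2 := alpha_nonneg hn (n / 2 - j)
  have h3 := alpha_nonneg hn (j - 1 - n / 2)
  rw [hEv]
  refine mul_nonneg (Real.sqrt_nonneg _) (add_nonneg ?_ ?_) <;> split_ifs <;> positivity

theorem hEv_le (hn : 2 ≤ n) (hε : 0 ≤ ε) (j : ℕ) : hEv ε n j ≤ 2 * (n : ℝ) ^ 2 * √ε := by
  have hn2 : (2 : ℝ) ≤ n := by exact_mod_cast hn
  have hroot := Real.sqrt_nonneg ε
  have h3 := sqrt_eps1_le hn hε
  have hp : (if j = 1 ∨ j = n then 0 else 1 / alpha n (j - 1)) ≤ (n : ℝ) := by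
    split_ifs
    · positivity
    · exact one_div_alpha_le hn _
  have hq : (if j = n / 2 ∨ j = n / 2 + 1 then 0
        else if j < n / 2 then 1 / alpha n (n / 2 - j) else 1 / alpha n (j - 1 - n / 2)) ≤
      (n : ℝ) := by
    split_ifs
    · positivity
    · exact one_div_alpha_le hn _
    · exact one_div_alpha_le hn _
  rw [hEv]
  calc _ ≤ √(eps1 ε n) * (n + n) := by gcongr
    _ ≤ 2 * √ε * (n + n) := by gcongr
    _ ≤ 2 * (n : ℝ) ^ 2 * √ε := by nlinarith [mul_nonneg hroot (by linarith : 0 ≤ (n : ℝ) - 2)]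

theorem omegaEv_lower (hn : 2 ≤ n) (hev : Even n) : (n : ℝ) ^ 2 * √ε ≤ omegaEv ε n := by
  refine le_trans ?_ (omegaEv_ge hn hev)
  have hs0 := sin_angle_pos hn
  have hn2 : (2 : ℝ) ≤ n := by exact_mod_cast hn
  have hle : n * Real.sin (Real.pi / (2 * n)) ≤ 1.6 := by
    have h1 := Real.sin_le (angle_pos hn).le
    have h2 := mul_angle hn
    have h3 := Real.pi_lt_d2
    have : n * Real.sin (Real.pi / (2 * n)) ≤ n * (Real.pi / (2 * n)) := by gcongr
    linarith
  have hc := four_fifths_le_sqrt_cos_angle hn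
  have h1 : 0 ≤ √2 * √(eps1 ε n) := by positivity
  have h2 : (n : ℝ) ^ 2 * √ε ≤ 2 * n * (√(Real.cos (Real.pi / (2 * n))) * √ε) /
      Real.sin (Real.pi / (2 * n)) := by
    rw [le_div_iff₀ hs0]
    calc (n : ℝ) ^ 2 * √ε * Real.sin (Real.pi / (2 * n)) =
        n * √ε * (n * Real.sin (Real.pi / (2 * n))) := by ring
      _ ≤ n * √ε * (2 * √(Real.cos (Real.pi / (2 * n)))) :=
          mul_le_mul_of_nonneg_left (by linarith) (by positivity)
      _ = _ := by ring
  linarith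

end Asymptotics

section FinalBounds

variable {n : ℕ} {ε : ℝ}

/-- There is an observable of Bob whose angle is far from those of `Z` and `X`. -/
theorem half_le_abs_sin_quarter (hn : 3 ≤ n) :
    1 / 2 ≤ |Real.sin (2 * ((2 * (n / 4) + 1 : ℕ) * (Real.pi / (2 * n))))| := by
  have hn3 : (3 : ℝ) ≤ n := by exact_mod_cast hn
  have hpi := Real.pi_pos
  have hle : |(n : ℝ) - 2 * (2 * (n / 4) + 1 : ℕ)| ≤ 2 := by
    have h : |(n : ℤ) - 2 * (2 * (n / 4) + 1 : ℕ)| ≤ 2 := by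
      rw [abs_le]
      omega
    exact_mod_cast h
  refine le_trans ?_ (le_abs_self _)
  rw [← Real.cos_pi_div_two_sub, ← Real.cos_abs, ← Real.cos_pi_div_three]
  have e : Real.pi / 2 - 2 * ((2 * (n / 4) + 1 : ℕ) * (Real.pi / (2 * n))) =
      ((n : ℝ) - 2 * (2 * (n / 4) + 1 : ℕ)) * (Real.pi / (2 * n)) := by
    field_simp
  have hb : |Real.pi / 2 - 2 * ((2 * (n / 4) + 1 : ℕ) * (Real.pi / (2 * n)))| ≤ Real.pi / 3 := by
    rw [e, abs_mul, abs_of_pos (angle_pos (by omega : 2 ≤ n))]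
    calc _ ≤ 2 * (Real.pi / (2 * n)) := by
          have := (angle_pos (by omega : 2 ≤ n)).le
          gcongr
      _ = Real.pi / n := by field_simp
      _ ≤ Real.pi / 3 := by gcongr
  exact Real.cos_le_cos_of_nonneg_of_le_pi (abs_nonneg _) (by linarith) hb

theorem abs_sin_quarter_two :
    |Real.sin (2 * ((2 * (2 / 4) + 1 : ℕ) * (Real.pi / (2 * (2 : ℕ)))))| = 1 := by
  rw [show 2 * (((2 * (2 / 4) + 1 : ℕ) : ℝ) * (Real.pi / (2 * (2 : ℕ)))) = Real.pi / 2 by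
    norm_num
    ring, Real.sin_pi_div_two, abs_one]

theorem anticommutator_bound_le_omegaEv (hn : 2 ≤ n) (hev : Even n) (hε : 0 ≤ ε) {S : ℝ}
    (hS : 1 / 2 ≤ S) (hS2 : n = 2 → S = 1) :
    2 * ((1 + √2) * √(ε / (S * Real.sin (Real.pi / (2 * n))))) ≤ omegaEv ε n := by
  refine le_trans ?_ (omegaEv_ge hn hev)
  have hs := sin_angle_pos hn
  have hc := cos_angle_pos hn
  have hsc := sin_angle_le_cos_angle hn
  have h2 : √2 ≤ 3 / 2 := (Real.sqrt_le_left (by norm_num)).2 (by norm_num)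
  have hr2 := Real.sq_sqrt (show (0 : ℝ) ≤ 2 by norm_num)
  have hr0 := Real.sqrt_nonneg 2
  set s := Real.sin (Real.pi / (2 * n)) with hsdef
  set c := Real.cos (Real.pi / (2 * n)) with hcdef
  have hr : 0 ≤ √(ε / s) := Real.sqrt_nonneg _
  have hmain : 2 * n * √(ε / s) ≤ 2 * n * (√c * √ε) / s := by
    have e : √(ε / s) = √s * √ε / s := by
      rw [Real.sqrt_div hε, div_eq_div_iff (Real.sqrt_pos.2 hs).ne' hs.ne']
      nth_rewrite 1 [← Real.mul_self_sqrt hs.le]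
      ring
    rw [e, ← mul_div_assoc]
    have := Real.sqrt_le_sqrt hsc
    gcongr
  rcases (by obtain ⟨m, hm⟩ := hev; omega : n = 2 ∨ 4 ≤ n) with h | h
  · have hcs : c = s := by
      rw [hcdef, hsdef, h]
      norm_num [show Real.pi / (2 * 2) = Real.pi / 4 by ring]
    rw [hS2 h, one_mul, eps1, ← hcdef, hcs]
    rw [hcs] at hmain
    have : (n : ℝ) = 2 := by exact_mod_cast h
    rw [this] at hmain ⊢
    nlinarith
  · have h4 : (4 : ℝ) ≤ n := by exact_mod_cast h
    have h5 : √(ε / (S * s)) ≤ √2 * √(ε / s) := by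
      rw [← Real.sqrt_mul (by norm_num)]
      refine Real.sqrt_le_sqrt ?_
      rw [← mul_div_assoc, div_le_div_iff₀ (by positivity) hs]
      have : 0 ≤ ε * s := by positivity
      nlinarith
    have h6 : 0 ≤ √2 * √(eps1 ε n) := by positivity
    have h7 : 2 * ((1 + √2) * √(ε / (S * s))) ≤ 8 * √(ε / s) := by
      have : 2 * ((1 + √2) * √(ε / (S * s))) ≤ 2 * ((1 + √2) * (√2 * √(ε / s))) := by gcongr
      nlinarith
    have h8 : 8 * √(ε / s) ≤ 2 * n * √(ε / s) := by
      gcongr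
      linarith
    linarith

theorem sqrt_div_sin_le (hn : 2 ≤ n) (hε : 0 ≤ ε) {S : ℝ} (hS : 1 / 2 ≤ S) :
    √(ε / (S * Real.sin (Real.pi / (2 * n)))) ≤ n * √ε := by
  have hs := sin_angle_pos hn
  have hs' := inv_le_sin_angle hn
  have hn2 : (2 : ℝ) ≤ n := by exact_mod_cast hn
  have h1 : 1 ≤ n * Real.sin (Real.pi / (2 * n)) := by
    rwa [div_le_iff₀' (by linarith)] at hs'
  have h2 : ε / (S * Real.sin (Real.pi / (2 * n))) ≤ (n : ℝ) ^ 2 * ε := by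
    rw [div_le_iff₀ (by positivity)]
    have h3 : 1 ≤ (n : ℝ) ^ 2 * (S * Real.sin (Real.pi / (2 * n))) := by
      have : 1 * 1 ≤ (n * S) * (n * Real.sin (Real.pi / (2 * n))) :=
        mul_le_mul (by nlinarith) h1 zero_le_one (by positivity)
      nlinarith
    nlinarith
  calc _ ≤ √((n : ℝ) ^ 2 * ε) := Real.sqrt_le_sqrt h2
    _ = n * √ε := by rw [Real.sqrt_mul (by positivity), Real.sqrt_sq (by positivity)]

/-- The error function for an odd number of measurements. -/
def boundOdd (ε : ℝ) (n : ℕ) : ℝ := 200 * (n : ℝ) ^ 2 * √ε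

theorem error_le_boundOdd (hn : 2 ≤ n) (hε : 0 ≤ ε) {S : ℝ} (hS : 1 / 2 ≤ S) {η ω : ℝ}
    (hη : √(ε / Real.sin (Real.pi / (2 * n))) + middleErr ε n = η)
    (hω : 2 * ((1 + √2) * (√(ε / (S * Real.sin (Real.pi / (2 * n)))) + middleErr ε n / S)) = ω) :
    0 ≤ η ∧ 0 ≤ ω ∧ (1 + √2) * η + (3 + 2 * √2) * ω + 10 * √(eps1 ε n) ≤ boundOdd ε n := by
  have hn2 : (2 : ℝ) ≤ n := by exact_mod_cast hn
  have h1 := sqrt_eps1_le hn hε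
  have hroot := Real.sqrt_nonneg ε
  have h2 : √2 ≤ 3 / 2 := (Real.sqrt_le_left (by norm_num)).2 (by norm_num)
  have hnr : 2 * √ε ≤ n * √ε := by gcongr
  have hm0 : 0 ≤ middleErr ε n := by rw [middleErr]; split_ifs <;> positivity
  have hm : middleErr ε n ≤ 2 * (n * √ε) := by
    rw [middleErr]
    split_ifs
    · positivity
    · linarith
  have hmS : middleErr ε n / S ≤ 4 * (n * √ε) := by
    rw [div_le_iff₀ (by linarith)]
    have : 0 ≤ n * √ε := by positivity
    nlinarith
  have hη1 : η ≤ 3 * (n * √ε) := by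
    have := sqrt_div_sin_le hn hε (S := 1) (by norm_num)
    rw [one_mul] at this
    linarith
  have hω1 : ω ≤ 25 * (n * √ε) := by
    have := sqrt_div_sin_le hn hε hS
    rw [← hω]
    calc _ ≤ 2 * ((1 + 3 / 2) * (n * √ε + 4 * (n * √ε))) := by
          have : 0 ≤ middleErr ε n / S := by positivity
          gcongr
      _ = _ := by ring
  have hη0 : 0 ≤ η := by rw [← hη]; positivity
  have hω0 : 0 ≤ ω := by rw [← hω]; positivity
  refine ⟨hη0, hω0, ?_⟩
  rw [boundOdd]
  calc _ ≤ (1 + 3 / 2) * (3 * (n * √ε)) + (3 + 2 * (3 / 2)) * (25 * (n * √ε)) +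
        10 * (n * √ε) := by
        gcongr
        linarith
    _ ≤ 200 * (n * √ε) := by
        have : 0 ≤ n * √ε := by positivity
        linarith
    _ ≤ 200 * (n : ℝ) ^ 2 * √ε := by
        have : (n : ℝ) ≤ (n : ℝ) ^ 2 := by nlinarith
        nlinarith

theorem error_le_boundEv (hn : 2 ≤ n) (hev : Even n) (hε : 0 ≤ ε) {S : ℝ} (hS : 1 / 2 ≤ S)
    (hS1 : S ≤ 1) (hS2 : n = 2 → S = 1) {η ω : ℝ}
    (hη : √(ε / Real.sin (Real.pi / (2 * n))) + middleErr ε n = η)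
    (hω : 2 * ((1 + √2) * (√(ε / (S * Real.sin (Real.pi / (2 * n)))) + middleErr ε n / S)) = ω) :
    (∀ i j, (1 + √2) * η + (3 + 2 * √2) * ω + 10 * √(eps1 ε n) ≤ boundEvAB i j ε n) ∧
    (∀ i, η + 3 * ω + 10 * √(eps1 ε n) ≤ boundEvA i ε n) ∧
    (∀ j, η + 3 * ω + 10 * √(eps1 ε n) ≤ boundEvB j ε n) ∧
    ω + 10 * √(eps1 ε n) ≤ boundEv ε n := by
  have hs := sin_angle_pos hn
  have hn2 : (2 : ℝ) ≤ n := by exact_mod_cast hn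
  have hm : middleErr ε n = 0 := if_pos hev
  rw [hm, add_zero] at hη
  rw [hm, zero_div, add_zero] at hω
  have hωle : ω ≤ omegaEv ε n := hω ▸ anticommutator_bound_le_omegaEv hn hev hε hS hS2
  have hηω : 2 * ((1 + √2) * η) ≤ ω := by
    rw [← hη, ← hω]
    gcongr
    exact mul_le_of_le_one_left hs.le hS1
  have hη0 : 0 ≤ η := hη ▸ Real.sqrt_nonneg _
  have h1 := sqrt_eps1_le' hn hε
  have hlow := omegaEv_lower (ε := ε) hn hev
  have hroot := Real.sqrt_nonneg ε
  have hroot1 := Real.sqrt_nonneg (eps1 ε n)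
  have hlow4 : 4 * √ε ≤ omegaEv ε n := le_trans (by gcongr; nlinarith) hlow
  have h2 : √2 ≤ 3 / 2 := (Real.sqrt_le_left (by norm_num)).2 (by norm_num)
  have h2' : 7 / 5 ≤ √2 := Real.le_sqrt_of_sq_le (by norm_num)
  have hω0 : 0 ≤ ω := le_trans (by positivity) hηω
  have e1 : 7 / 5 * √(eps1 ε n) ≤ √2 * √(eps1 ε n) := by gcongr
  have e2 : √2 * ω ≤ 3 / 2 * ω := by gcongr
  have e3 : 7 / 5 * η ≤ √2 * η := by gcongr
  refine ⟨fun i j => ?_, fun i => ?_, fun j => ?_, ?_⟩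
  · have hg := gEv_nonneg (ε := ε) hn i
    have hh := hEv_nonneg (ε := ε) hn j
    rw [boundEvAB, normErr]
    linarith
  · have hg := gEv_nonneg (ε := ε) hn i
    rw [boundEvA, normErr]
    linarith
  · have hh := hEv_nonneg (ε := ε) hn j
    rw [boundEvB, normErr]
    linarith
  · rw [boundEv, normErr]
    linarith

theorem boundEv_order (hn : 2 ≤ n) (hev : Even n) (hε : 0 ≤ ε) {i : ℕ} (hi : i ∈ Finset.Icc 1 n)
    (j : ℕ) {x : ℝ}
    (hx : x ∈ ({boundEv ε n, boundEvA i ε n, boundEvB j ε n, boundEvAB i j ε n} : Set ℝ)) :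
    (n : ℝ) ^ 2 * √ε ≤ x ∧ x ≤ 200 * (n : ℝ) ^ 2 * √ε := by
  have hn2 : (2 : ℝ) ≤ n := by exact_mod_cast hn
  have hg := gEv_nonneg (ε := ε) hn i
  have hh := hEv_nonneg (ε := ε) hn j
  have hg' := gEv_le hn hε hi
  have hh' := hEv_le hn hε j
  have hlow := omegaEv_lower (ε := ε) hn hev
  have hup := omegaEv_le hn hev hε
  have h1 := sqrt_eps1_le hn hε
  have hroot := Real.sqrt_nonneg ε
  have hroot1 := Real.sqrt_nonneg (eps1 ε n)
  have h2 : √2 ≤ 3 / 2 := (Real.sqrt_le_left (by norm_num)).2 (by norm_num)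
  have e1 : √2 * √(eps1 ε n) ≤ 3 / 2 * √(eps1 ε n) := by gcongr
  have e2 : 0 ≤ √2 * √(eps1 ε n) := by positivity
  have e3 : 4 * √ε ≤ (n : ℝ) ^ 2 * √ε := by gcongr; nlinarith
  simp only [Set.mem_insert_iff, Set.mem_singleton_iff] at hx
  rcases hx with rfl | rfl | rfl | rfl
  · rw [boundEv, normErr]
    constructor <;> linarith
  · rw [boundEvA, normErr]
    constructor <;> linarith
  · rw [boundEvB, normErr]
    constructor <;> linarith
  · rw [boundEvAB, normErr]
    constructor <;> linarith

theorem tendsto_zero_of_order {g : ℝ → ℝ} {c C : ℝ}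
    (h : ∀ ε, 0 ≤ ε → c * √ε ≤ g ε ∧ g ε ≤ C * √ε) : Filter.Tendsto g (𝓝[≥] 0) (𝓝 0) := by
  have hlim (r : ℝ) : Filter.Tendsto (fun ε => r * √ε) (𝓝[≥] 0) (𝓝 0) := by
    have : Filter.Tendsto (fun ε => r * √ε) (𝓝 0) (𝓝 (r * √0)) :=
      (continuous_const.mul Real.continuous_sqrt).tendsto 0
    rw [Real.sqrt_zero, mul_zero] at this
    exact this.mono_left nhdsWithin_le_nhds
  refine tendsto_of_tendsto_of_tendsto_of_le_of_le' (hlim c) (hlim C) ?_ ?_ <;>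
  filter_upwards [self_mem_nhdsWithin] with ε hε
  exacts [(h ε hε).1, (h ε hε).2]

end FinalBounds

end ChainedBell

end

theorem theorem2 :
    ∃ (f : ℝ → ℕ → ℝ) (fA fB : ℕ → ℝ → ℕ → ℝ) (fAB : ℕ → ℕ → ℝ → ℕ → ℝ),
      -- for even `n` the error functions are the explicit ones
      (∀ (ε : ℝ) (n : ℕ), Even n →
        f ε n = ChainedBell.boundEv ε n ∧
        (∀ i, fA i ε n = ChainedBell.boundEvA i ε n) ∧
        (∀ j, fB j ε n = ChainedBell.boundEvB j ε n) ∧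
        (∀ i j, fAB i j ε n = ChainedBell.boundEvAB i j ε n)) ∧
      -- they vanish as `ε → 0`
      (∀ n : ℕ, 2 ≤ n → ∀ i ∈ Finset.Icc 1 n, ∀ j ∈ Finset.Icc 1 n,
        ∀ g ∈ ({fun ε => f ε n, fun ε => fA i ε n, fun ε => fB j ε n, fun ε => fAB i j ε n} :
            Set (ℝ → ℝ)),
          Filter.Tendsto g (𝓝[≥] 0) (𝓝 0)) ∧
      -- they are of the exact order `n ^ 2 √ε`
      (∃ c C : ℝ, 0 < c ∧ 0 < C ∧ ∀ n : ℕ, 2 ≤ n → ∀ ε : ℝ, 0 ≤ ε →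
        ∀ i ∈ Finset.Icc 1 n, ∀ j ∈ Finset.Icc 1 n,
          ∀ x ∈ ({f ε n, fA i ε n, fB j ε n, fAB i j ε n} : Set ℝ),
            c * (n : ℝ) ^ 2 * √ε ≤ x ∧ x ≤ C * (n : ℝ) ^ 2 * √ε) ∧
      -- they bound the distances
      (∀ (HA : Type*) (HB : Type*)
        [NormedAddCommGroup HA] [InnerProductSpace ℂ HA] [CompleteSpace HA]
        [NormedAddCommGroup HB] [InnerProductSpace ℂ HB] [CompleteSpace HB]
        (n : ℕ) (_ : 2 ≤ n) (ε : ℝ) (_ : 0 ≤ ε)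
        (A : ℕ → HA →L[ℂ] HA) (B : ℕ → HB →L[ℂ] HB) (ψ : ChainedBell.Joint HA HB)
        (_ : ∀ i ∈ Finset.Icc 1 n, ChainedBell.IsBinaryObservable (A i))
        (_ : ∀ j ∈ Finset.Icc 1 n, ChainedBell.IsBinaryObservable (B j))
        (_ : ‖ψ‖ = 1)
        (_ : ChainedBell.bellValue n A B ψ = ((ChainedBell.bellMax n - ε : ℝ) : ℂ)),
        (∀ i ∈ Finset.Icc 1 n, ∀ j ∈ Finset.Icc 1 n,
          ‖ChainedBell.Phi n A B
                (ChainedBell.prodVec (ChainedBell.tensorOp (A i) (B j) ψ) ChainedBell.ket00) -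
              ChainedBell.prodVec (ChainedBell.junk n A B ψ)
                ((ChainedBell.refA n i ⊗ₖ ChainedBell.refB n j).mulVec ChainedBell.phiPlus)‖
            ≤ fAB i j ε n) ∧
        (∀ i ∈ Finset.Icc 1 n,
          ‖ChainedBell.Phi n A B
                (ChainedBell.prodVec (ChainedBell.onA (A i) ψ) ChainedBell.ket00) -
              ChainedBell.prodVec (ChainedBell.junk n A B ψ)
                ((ChainedBell.refA n i ⊗ₖ 1).mulVec ChainedBell.phiPlus)‖
            ≤ fA i ε n) ∧
        (∀ j ∈ Finset.Icc 1 n,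
          ‖ChainedBell.Phi n A B
                (ChainedBell.prodVec (ChainedBell.onB (B j) ψ) ChainedBell.ket00) -
              ChainedBell.prodVec (ChainedBell.junk n A B ψ)
                ((1 ⊗ₖ ChainedBell.refB n j).mulVec ChainedBell.phiPlus)‖
            ≤ fB j ε n) ∧
        ‖ChainedBell.Phi n A B (ChainedBell.prodVec ψ ChainedBell.ket00) -
            ChainedBell.prodVec (ChainedBell.junk n A B ψ) ChainedBell.phiPlus‖
          ≤ f ε n) := by
  have order : ∀ n : ℕ, 2 ≤ n → ∀ ε : ℝ, 0 ≤ ε → ∀ i ∈ Finset.Icc 1 n, ∀ j ∈ Finset.Icc 1 n,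
      ∀ x ∈ ({if Even n then ChainedBell.boundEv ε n else ChainedBell.boundOdd ε n,
        if Even n then ChainedBell.boundEvA i ε n else ChainedBell.boundOdd ε n,
        if Even n then ChainedBell.boundEvB j ε n else ChainedBell.boundOdd ε n,
        if Even n then ChainedBell.boundEvAB i j ε n else ChainedBell.boundOdd ε n} : Set ℝ),
      1 * (n : ℝ) ^ 2 * √ε ≤ x ∧ x ≤ 200 * (n : ℝ) ^ 2 * √ε := by
    intro n hn ε hε i hi j hj x hx
    rw [one_mul]
    by_cases hev : Even n
    · simp only [if_pos hev] at hx
      exact ChainedBell.boundEv_order hn hev hε hi j hx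
    · simp only [if_neg hev, Set.mem_insert_iff, Set.mem_singleton_iff, or_self] at hx
      rw [hx, ChainedBell.boundOdd]
      have : 0 ≤ (n : ℝ) ^ 2 * √ε := by positivity
      constructor <;> linarith
  refine ⟨fun ε n => if Even n then ChainedBell.boundEv ε n else ChainedBell.boundOdd ε n,
    fun i ε n => if Even n then ChainedBell.boundEvA i ε n else ChainedBell.boundOdd ε n,
    fun j ε n => if Even n then ChainedBell.boundEvB j ε n else ChainedBell.boundOdd ε n,
    fun i j ε n => if Even n then ChainedBell.boundEvAB i j ε n else ChainedBell.boundOdd ε n,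
    fun ε n hev => ?_, fun n hn i hi j hj g hg => ?_,
    ⟨1, 200, one_pos, by norm_num, order⟩, ?_⟩
  · simp only [if_pos hev, implies_true, and_self]
  · refine ChainedBell.tendsto_zero_of_order (c := 1 * (n : ℝ) ^ 2) (C := 200 * (n : ℝ) ^ 2)
      fun ε hε => order n hn ε hε i hi j hj _ ?_
    simp only [Set.mem_insert_iff, Set.mem_singleton_iff] at hg ⊢
    rcases hg with rfl | rfl | rfl | rfl <;> simp
  · intro HA HB _ _ _ _ _ _ n hn ε hε A B ψ hA hB hψ hbell
    obtain ⟨S, hSdef⟩ : ∃ S, |Real.sin (2 * ((2 * (n / 4) + 1 : ℕ) * (Real.pi / (2 * n))))| = S :=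
      ⟨_, rfl⟩
    have hS2 : n = 2 → S = 1 := by
      rintro rfl
      rw [← hSdef]
      exact ChainedBell.abs_sin_quarter_two
    have hS : 1 / 2 ≤ S := by
      rcases hn.eq_or_lt with h | h
      · rw [hS2 h.symm]
        norm_num
      · exact hSdef ▸ ChainedBell.half_le_abs_sin_quarter h
    have hS1 : S ≤ 1 := hSdef ▸ Real.abs_sin_le_one _
    have hω := ChainedBell.norm_anticommutator_le hn hA hB hψ hbell
      (j := n / 4) (by omega) (by linarith) hSdef
    obtain ⟨h1, h2, h3, h4⟩ := ChainedBell.self_test_bounds hn hA hB hψ hε hbell hω rfl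
    by_cases hev : Even n
    · simp only [if_pos hev]
      obtain ⟨b1, b2, b3, b4⟩ := ChainedBell.error_le_boundEv hn hev hε hS hS1 hS2 rfl rfl
      exact ⟨fun i hi j hj => (h1 i hi j hj).trans (b1 i j), fun i hi => (h2 i hi).trans (b2 i),
        fun j hj => (h3 j hj).trans (b3 j), h4.trans b4⟩
    · simp only [if_neg hev]
      obtain ⟨hη0, hω0, b⟩ := ChainedBell.error_le_boundOdd hn hε hS rfl rfl
      have hr := Real.sqrt_nonneg 2
      have e1 := mul_nonneg hr hη0
      have e2 := mul_nonneg hr hω0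
      exact ⟨fun i hi j hj => (h1 i hi j hj).trans b,
        fun i hi => (h2 i hi).trans (le_trans (by linarith) b),
        fun j hj => (h3 j hj).trans (le_trans (by linarith) b),
        h4.trans (le_trans (by linarith) b)⟩
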